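/- Let $m\ge 1$ be an integer. For $f\in C^0(\mathbb S^m)$ let $$\widehat{\mathcal R}[f](\zeta):=\frac1{\mathscr H^{m-1}(\mathbb S^{m-1})}\int_{\mathbb S^m\cap\zeta^\perp}f(\omega)\,d\mathscr H^{m-1}(\omega),\qquad \zeta\in\mathbb S^m,$$ be the spherical Radon transform, where $\mathscr H^{m-1}$ is the $(m-1)$-dimensional Hausdorff measure and $\mathbb S^m\subset\mathbb R^{m+1}$ is the unit sphere, and for $g\in C^0(\mathbb R^{m+1}\setminus\{0\})$ let $$\mathcal R[g](Z):=\frac1{|Z|}\,\widehat{\mathcal R}\big[g|_{\mathbb S^m}\big]\Big(\frac Z{|Z|}\Big),\qquad Z\in\mathbb R^{m+1}\setminus\{0\},$$ be the extended spherical Radon transform. Equip the space $C^\infty(\mathbb R^{m+1}\setminus\{0\})$ of real-valued smooth functions with the topology generated by the seminorms $$p_k(f):=\max\{|D^\alpha f(Z)|:\ \tfrac1{k+1}\le|Z|\le k+1,\ |\alpha|\le k\},\qquad k=0,1,2,\dots,$$ and for $q\in\mathbb R$ let $E_q\subset C^\infty(\mathbb R^{m+1}\setminus\{0\})$, with the subspace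 topology, be the linear subspace of all $f$ that are even, $f(-y)=f(y)$, and positively $q$-homogeneous, $f(ty)=t^qf(y)$ for all $t>0$, $y\ne0$. Theorem. The spaces $E_{-m}$ and $E_{-1}$ are Fréchet spaces, and the restriction of $\mathcal R$ to $E_{-m}$ is a continuous linear bijection from $E_{-m}$ onto $E_{-1}$, whose inverse $\mathcal T:E_{-1}\to E_{-m}$ is continuous. -/

import Mathlib

open scoped ContDiff MeasureTheory Topology Pointwise

noncomputable section

namespace SphericalRadon

/-- The Euclidean space `ℝ^{m+1}`. -/
abbrev Space (m : ℕ) : Type := EuclideanSpace ℝ (Fin (m + 1))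

/-! ### The spherical Radon transform and its homogeneous extension -/

/-- The spherical Radon transform
`f ↦ (1 / H^{m-1}(S^{m-1})) ∫_{S^m ∩ ζ^⊥} f dH^{m-1}`, for `m ≥ 1` and `ζ ∈ S^m`.
It only depends on the values of `f` on the unit sphere `S^m ⊆ ℝ^{m+1}`.
Here `μHE[d]` is the `d`-dimensional Hausdorff measure, normalised so that it agrees with Lebesgue
measure on `ℝ^d` (counting measure for `d = 0`). -/
def radonHat (m : ℕ) (f : Space m → ℝ) (ζ : Space m) : ℝ :=
  (μHE[m - 1].real (Metric.sphere (0 : EuclideanSpace ℝ (Fin m)) 1))⁻¹ *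
    ∫ x in Metric.sphere (0 : Space m) 1 ∩ {x | inner ℝ ζ x = 0}, f x ∂μHE[m - 1]

/-- The extended spherical Radon transform
`R[g](Z) = |Z|⁻¹ * radonHat (g|_{S^m}) (Z / |Z|)` for `Z ≠ 0` (and `0` at `Z = 0`). -/
def radon (m : ℕ) (g : Space m → ℝ) (Z : Space m) : ℝ :=
  ‖Z‖⁻¹ * radonHat m g (‖Z‖⁻¹ • Z)

/-! ### The space `C^∞(ℝ^{m+1} ∖ {0})` and its topology -/

/-- Real functions that are smooth on `ℝ^{m+1} ∖ {0}`. A function on `ℝ^{m+1} ∖ {0}` is represented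
by its extension by the value `0` at the origin, so that equality of two representatives is equality
on `ℝ^{m+1} ∖ {0}`. -/
def smoothSubmodule (m : ℕ) : Submodule ℝ (Space m → ℝ) where
  carrier := {f | ContDiffOn ℝ ∞ f {0}ᶜ ∧ f 0 = 0}
  add_mem' := fun ha hb => ⟨ha.1.add hb.1, by simp [ha.2, hb.2]⟩
  zero_mem' := ⟨contDiffOn_const, rfl⟩
  smul_mem' := fun c _ ha => ⟨contDiffOn_const.smul ha.1, by simp [ha.2]⟩

/-- The vector space `C^∞(ℝ^{m+1} ∖ {0})`. (This is a type of its own, so that it does not carry the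
topology of pointwise convergence.) -/
def SmoothPunctured (m : ℕ) : Type := smoothSubmodule m

instance (m : ℕ) : AddCommGroup (SmoothPunctured m) :=
  inferInstanceAs (AddCommGroup (smoothSubmodule m))

instance (m : ℕ) : Module ℝ (SmoothPunctured m) :=
  inferInstanceAs (Module ℝ (smoothSubmodule m))

instance (m : ℕ) : CoeFun (SmoothPunctured m) (fun _ => Space m → ℝ) :=
  ⟨fun f => f.1⟩

/-- The iterated partial derivative `∂_{i₁} ⋯ ∂_{iⱼ} f (Z)`. For smooth `f`, these are the
derivatives `D^α f (Z)` with `|α| = j`. -/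
def partialDeriv {m : ℕ} (f : Space m → ℝ) {j : ℕ} (i : Fin j → Fin (m + 1)) (Z : Space m) : ℝ :=
  iteratedFDeriv ℝ j f Z (fun l => EuclideanSpace.single (i l) (1 : ℝ))

/-- The compact shell `S_k`: the closed ball of radius `k + 1` minus the open ball of radius
`1 / (k + 1)`, both centred at the origin. -/
def shell (m k : ℕ) : Set (Space m) :=
  Metric.closedBall 0 ((k : ℝ) + 1) \ Metric.ball 0 (1 / ((k : ℝ) + 1))

/-- The set of the numbers `|D^α f (Z)|` for `|α| ≤ k` and `Z ∈ S_k`. -/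
def derivValues {m : ℕ} (k : ℕ) (f : Space m → ℝ) : Set ℝ :=
  {r | ∃ j ≤ k, ∃ i : Fin j → Fin (m + 1), ∃ Z ∈ shell m k, r = |partialDeriv f i Z|}

theorem shell_subset (m k : ℕ) : shell m k ⊆ {0}ᶜ := by
  rintro Z hZ rfl
  exact hZ.2 (Metric.mem_ball_self (by positivity))

theorem isCompact_shell (m k : ℕ) : IsCompact (shell m k) :=
  (isCompact_closedBall _ _).diff Metric.isOpen_ball

theorem derivValues_nonempty {m : ℕ} (k : ℕ) (f : Space m → ℝ) : (derivValues k f).Nonempty := by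
  refine ⟨_, 0, Nat.zero_le _, Fin.elim0, EuclideanSpace.single 0 1, ?_, rfl⟩
  have hk : (0 : ℝ) ≤ k := Nat.cast_nonneg k
  constructor
  · simp
  · simp only [Metric.mem_ball, dist_zero_right, PiLp.norm_single, norm_one, not_lt]
    rw [div_le_one (by positivity)]
    linarith

theorem SmoothPunctured.contDiffAt {m : ℕ} (f : SmoothPunctured m) {Z : Space m}
    (hZ : Z ∈ ({0}ᶜ : Set (Space m)))
    (j : ℕ) : ContDiffAt ℝ j f Z :=
  ((f.2.1.contDiffAt (isOpen_compl_singleton.mem_nhds hZ)).of_le (by exact_mod_cast le_top))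

theorem derivValues_bddAbove {m : ℕ} (k : ℕ) (f : SmoothPunctured m) :
    BddAbove (derivValues k f) := by
  have h : ∀ j : ℕ, ∃ C : ℝ, ∀ Z ∈ shell m k, ‖iteratedFDeriv ℝ j f Z‖ ≤ C := by
    intro j
    refine (isCompact_shell m k).exists_bound_of_continuousOn ?_
    have h1 : ContinuousOn (iteratedFDerivWithin ℝ j f {0}ᶜ) {0}ᶜ :=
      f.2.1.continuousOn_iteratedFDerivWithin (by exact_mod_cast le_top)
        isOpen_compl_singleton.uniqueDiffOn
    refine (h1.congr ?_).mono (shell_subset m k)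
    intro Z hZ
    exact (iteratedFDerivWithin_of_isOpen j isOpen_compl_singleton hZ).symm
  choose C hC using h
  refine ⟨∑ j ∈ Finset.range (k + 1), |C j|, ?_⟩
  rintro r ⟨j, hj, i, Z, hZ, rfl⟩
  calc |partialDeriv f i Z|
      ≤ ‖iteratedFDeriv ℝ j f Z‖ * ∏ l, ‖EuclideanSpace.single (i l) (1 : ℝ)‖ :=
        (iteratedFDeriv ℝ j f Z).le_opNorm _
    _ = ‖iteratedFDeriv ℝ j f Z‖ := by simp
    _ ≤ |C j| := (hC j Z hZ).trans (le_abs_self _)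
    _ ≤ _ := Finset.single_le_sum (f := fun j => |C j|) (fun _ _ => abs_nonneg _)
        (Finset.mem_range.mpr (by omega))

/-- The seminorm `p_k(f) = max {|D^α f (Z)| : Z ∈ S_k, |α| ≤ k}` on `C^∞(ℝ^{m+1} ∖ {0})`. -/
def seminorm (m k : ℕ) : Seminorm ℝ (SmoothPunctured m) :=
  Seminorm.of (fun f => sSup (derivValues k f))
    (by
      intro f g
      refine csSup_le (derivValues_nonempty k _) ?_
      rintro r ⟨j, hj, i, Z, hZ, rfl⟩
      have hZ' := shell_subset m k hZ
      have h : partialDeriv (f + g : SmoothPunctured m) i Z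
          = partialDeriv f i Z + partialDeriv g i Z := by
        change iteratedFDeriv ℝ j ((f : Space m → ℝ) + (g : Space m → ℝ)) Z _ = _
        rw [iteratedFDeriv_add_apply (f.contDiffAt hZ' j) (g.contDiffAt hZ' j)]
        rfl
      rw [h]
      exact (abs_add_le _ _).trans (add_le_add
        (le_csSup (derivValues_bddAbove k f) ⟨j, hj, i, Z, hZ, rfl⟩)
        (le_csSup (derivValues_bddAbove k g) ⟨j, hj, i, Z, hZ, rfl⟩)))
    (by
      intro c f
      have h : derivValues k (c • f : SmoothPunctured m) = ‖c‖ • derivValues k f := by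
        have h' : ∀ (j : ℕ) (i : Fin j → Fin (m + 1)), ∀ Z ∈ shell m k,
            |partialDeriv (c • f : SmoothPunctured m) i Z| = ‖c‖ * |partialDeriv f i Z| := by
          intro j i Z hZ
          change |iteratedFDeriv ℝ j (c • (f : Space m → ℝ)) Z _| = _
          rw [iteratedFDeriv_const_smul_apply (f.contDiffAt (shell_subset m k hZ) j)]
          exact abs_mul _ _
        ext r
        constructor
        · rintro ⟨j, hj, i, Z, hZ, rfl⟩
          exact ⟨_, ⟨j, hj, i, Z, hZ, rfl⟩, (h' j i Z hZ).symm⟩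
        · rintro ⟨_, ⟨j, hj, i, Z, hZ, rfl⟩, rfl⟩
          exact ⟨j, hj, i, Z, hZ, (h' j i Z hZ).symm⟩
      rw [h, Real.sSup_smul_of_nonneg (norm_nonneg c), smul_eq_mul])

/-- The family of the seminorms `p_0, p_1, p_2, …`. -/
def seminormFamily (m : ℕ) : SeminormFamily ℝ (SmoothPunctured m) ℕ := seminorm m

/-- `C^∞(ℝ^{m+1} ∖ {0})` carries the topology generated by the seminorms `p_0, p_1, p_2, …`. -/
instance (m : ℕ) : TopologicalSpace (SmoothPunctured m) :=
  (seminormFamily m).moduleFilterBasis.topology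

theorem withSeminorms (m : ℕ) : WithSeminorms (seminormFamily m) := ⟨rfl⟩

/-- The even and positively `q`-homogeneous functions in `C^∞(ℝ^{m+1} ∖ {0})`, with the subspace
topology. -/
def evenHomogeneous (m : ℕ) (q : ℝ) : Submodule ℝ (SmoothPunctured m) where
  carrier := {f | (∀ y, f (-y) = f y) ∧ ∀ t : ℝ, 0 < t → ∀ y, y ≠ 0 → f (t • y) = t ^ q * f y}
  add_mem' := by
    rintro a b ⟨ha, ha'⟩ ⟨hb, hb'⟩
    refine ⟨fun y => ?_, fun t ht y hy => ?_⟩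
    · exact congrArg₂ (· + ·) (ha y) (hb y)
    · exact (congrArg₂ (· + ·) (ha' t ht y hy) (hb' t ht y hy)).trans (mul_add _ _ _).symm
  zero_mem' := ⟨fun _ => rfl, fun _ _ _ _ => (mul_zero _).symm⟩
  smul_mem' := by
    rintro c a ⟨ha, ha'⟩
    refine ⟨fun y => ?_, fun t ht y hy => ?_⟩
    · exact congrArg (c * ·) (ha y)
    · exact (congrArg (c * ·) (ha' t ht y hy)).trans (mul_left_comm _ _ _)

/-- A real topological vector space is a Fréchet space if it is locally convex, Hausdorff, first
countable (with Hausdorff: metrizable) and complete; completeness is expressed through Cauchy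
sequences, as is equivalent under first countability. -/
structure IsFrechetSpace (E : Type*) [AddCommGroup E] [Module ℝ E] [TopologicalSpace E] :
    Prop where
  isTopologicalAddGroup : IsTopologicalAddGroup E
  continuousSMul : ContinuousSMul ℝ E
  locallyConvexSpace : LocallyConvexSpace ℝ E
  t2Space : T2Space E
  firstCountableTopology : FirstCountableTopology E
  complete : ∀ u : ℕ → E,
    (∀ U ∈ 𝓝 (0 : E), ∃ N : ℕ, ∀ a ≥ N, ∀ b ≥ N, u a - u b ∈ U) →
      ∃ x : E, Filter.Tendsto u Filter.atTop (𝓝 x)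

end SphericalRadon

end

noncomputable section

namespace SphericalRadon

open Filter Set MeasureTheory SchwartzMap FourierTransform

/-! ### The seminorms in terms of the norms of the iterated derivatives -/

/-! The Radon transform on degree `-m` is, up to a constant, the Fourier transform of an even
homogeneous distribution on `ℝ^{m+1}`, and the Fourier transform is its own inverse on even
functions. It exchanges the degrees `-(q+1)` and `-(p+1)` whenever `p + q + 1 = m`; the case `p =
0`, `q = m - 1` is the theorem.

Distributions are avoided as follows. Let `χ` be a radial cutoff supported away from the origin, `F`
the cosine transform, and `ray_p h (x) = ∫ s^p h(s x) ds` over `s > 0`. If `f` has degree `-(p+1)`,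
then `ray_p (χ f) = c f` with a constant `c > 0` (`rayIntegral_cutoff`), so `ray_p` recovers `f`
from the Schwartz function `χ f`. The operator `K_p f = ray_p (F (χ f))`, called `kernelOp`, is
composed of maps that are continuous for the Schwartz and shell seminorms, and its values have
degree `-(p+1)`.

The inversion `K_q K_p = c^2` on degree `-(q+1)` rests on the duality `∫ ray_p(F h) u = ∫ ray_q(h) F
u` (`integral_rayIntegral_cosTransform`): if `ray_q h` vanishes off the origin, so does `ray_p (F
h)`. With the roles of `p` and `q` exchanged this applies to the difference of `χ K_p f` and `c F(χ
f)`, which have the same `p`-ray integral.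

Finally, `K_0 g (ζ)` is half the integral of `F(χ g)` over the line through `ζ`, hence by the
Fourier slice theorem half the integral of `χ g` over `ζ^⊥`. Polar coordinates turn this into a
spherical average. That the average may be taken with Hausdorff measure follows from the uniqueness
of uniformly distributed measures (`integral_eq_of_uniform`). -/

theorem sum_single_eq {m : ℕ} (v : Space m) :
    v = ∑ a, v a • EuclideanSpace.single a (1 : ℝ) := by
  simpa using ((EuclideanSpace.basisFun (Fin (m + 1)) ℝ).sum_repr v).symm

theorem opNorm_le_sum_single {m j : ℕ}
    (T : ContinuousMultilinearMap ℝ (fun _ : Fin j => Space m) ℝ) :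
    ‖T‖ ≤ ∑ i : Fin j → Fin (m + 1), |T fun l => EuclideanSpace.single (i l) (1 : ℝ)| := by
  refine T.opNorm_le_bound (Finset.sum_nonneg fun _ _ => abs_nonneg _) fun v => ?_
  have h : T v = ∑ i : Fin j → Fin (m + 1),
      (∏ l, v l (i l)) * T fun l => EuclideanSpace.single (i l) (1 : ℝ) := by
    have h1 : v = fun l => ∑ a, v l a • EuclideanSpace.single a (1 : ℝ) :=
      funext fun l => sum_single_eq (v l)
    conv_lhs => rw [h1]
    rw [T.map_sum]
    refine Finset.sum_congr rfl fun i _ => ?_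
    rw [T.map_smul_univ, smul_eq_mul]
  rw [h, Finset.sum_mul]
  refine (norm_sum_le _ _).trans (Finset.sum_le_sum fun i _ => ?_)
  rw [norm_mul, mul_comm, Real.norm_eq_abs]
  refine mul_le_mul_of_nonneg_left ?_ (abs_nonneg _)
  rw [norm_prod]
  exact Finset.prod_le_prod (fun _ _ => norm_nonneg _) fun l _ => PiLp.norm_apply_le (v l) (i l)

/-- Multilinear expansion in the standard basis; `(m + 1) ^ j` counts the index tuples. With
`seminorm_le` this allows operator norms to replace partial derivatives throughout. -/
theorem norm_iteratedFDeriv_le_seminorm {m k j : ℕ} (hj : j ≤ k) (f : SmoothPunctured m)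
    {Z : Space m} (hZ : Z ∈ shell m k) :
    ‖iteratedFDeriv ℝ j f Z‖ ≤ ((m : ℝ) + 1) ^ j * seminorm m k f := by
  refine (opNorm_le_sum_single _).trans ?_
  have h : ∀ i : Fin j → Fin (m + 1),
      |iteratedFDeriv ℝ j f Z fun l => EuclideanSpace.single (i l) (1 : ℝ)| ≤ seminorm m k f :=
    fun i => le_csSup (derivValues_bddAbove k f) ⟨j, hj, i, Z, hZ, rfl⟩
  refine (Finset.sum_le_sum fun i _ => h i).trans ?_
  simp

theorem seminorm_le {m k : ℕ} (f : SmoothPunctured m) {C : ℝ}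
    (h : ∀ j ≤ k, ∀ Z ∈ shell m k, ‖iteratedFDeriv ℝ j f Z‖ ≤ C) : seminorm m k f ≤ C := by
  refine csSup_le (derivValues_nonempty k _) ?_
  rintro r ⟨j, hj, i, Z, hZ, rfl⟩
  refine ((iteratedFDeriv ℝ j f Z).le_opNorm _).trans ?_
  simpa using h j hj Z hZ

/-- Turns uniform convergence on shells into locally uniform convergence off the origin. -/
theorem exists_shell_mem_nhds {m : ℕ} (j : ℕ) {Z : Space m} (hZ : Z ≠ 0) :
    ∃ k, j ≤ k ∧ shell m k ∈ 𝓝 Z := by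
  have hZ' : 0 < ‖Z‖ := norm_pos_iff.mpr hZ
  obtain ⟨k₁, hk₁⟩ := exists_nat_gt ‖Z‖
  obtain ⟨k₂, hk₂⟩ := exists_nat_one_div_lt hZ'
  refine ⟨max j (max k₁ k₂), le_max_left _ _, ?_⟩
  set k := max j (max k₁ k₂)
  have h1 : (k₁ : ℝ) ≤ k := by exact_mod_cast (le_max_left _ _).trans (le_max_right _ _)
  have h2 : (k₂ : ℝ) ≤ k := by exact_mod_cast (le_max_right _ _).trans (le_max_right _ _)
  have h3 : 1 / ((k : ℝ) + 1) ≤ 1 / ((k₂ : ℝ) + 1) :=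
    one_div_le_one_div_of_le (by positivity) (by linarith)
  have h4 : ‖Z‖ < (k : ℝ) + 1 := by linarith
  have h5 : 1 / ((k : ℝ) + 1) < ‖Z‖ := by linarith
  filter_upwards [continuous_norm.continuousAt.eventually_lt_const h4,
    continuous_norm.continuousAt.eventually_const_lt h5] with x hx1 hx2
  exact ⟨by simpa using hx1.le, by simpa using hx2.le⟩

theorem SmoothPunctured.ext {m : ℕ} {f g : SmoothPunctured m} (h : ∀ x, f x = g x) : f = g :=
  Subtype.ext (funext h)

theorem SmoothPunctured.map_zero {m : ℕ} (f : SmoothPunctured m) : f 0 = 0 := f.2.2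

theorem iteratedFDeriv_sub_apply' {m j : ℕ} (f g : SmoothPunctured m) {Z : Space m} (hZ : Z ≠ 0) :
    iteratedFDeriv ℝ j (f - g : SmoothPunctured m) Z =
      iteratedFDeriv ℝ j f Z - iteratedFDeriv ℝ j g Z :=
  iteratedFDeriv_sub_apply (f.contDiffAt hZ j) (g.contDiffAt hZ j)

/-! ### Completeness -/

/-- All derivatives are uniformly Cauchy on shells, so they converge locally uniformly, and the
limit of the derivatives is the derivative of the limit. -/
theorem exists_limit_of_cauchy {m : ℕ} (u : ℕ → SmoothPunctured m)
    (hu : ∀ k, ∀ ε > 0, ∃ N, ∀ a ≥ N, ∀ b ≥ N, seminorm m k (u a - u b) < ε) :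
    ∃ f : SmoothPunctured m, ∀ k, ∀ ε > 0, ∃ N, ∀ a ≥ N, seminorm m k (u a - f) < ε := by
  classical
  -- the derivatives are uniformly Cauchy on shells
  have hc : ∀ j k, j ≤ k → UniformCauchySeqOn (fun n => iteratedFDeriv ℝ j (u n)) atTop
      (shell m k) := by
    intro j k hjk
    rw [Metric.uniformCauchySeqOn_iff]
    intro ε hε
    obtain ⟨N, hN⟩ := hu k (ε / ((m : ℝ) + 1) ^ j) (by positivity)
    refine ⟨N, fun a ha b hb Z hZ => ?_⟩
    rw [dist_eq_norm, ← iteratedFDeriv_sub_apply' _ _ (shell_subset m k hZ)]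
    refine (norm_iteratedFDeriv_le_seminorm hjk _ hZ).trans_lt ?_
    rw [← lt_div_iff₀' (by positivity)]
    exact hN a ha b hb
  have hl : ∀ j, ∀ Z : Space m, ∃ T : ContinuousMultilinearMap ℝ (fun _ : Fin j => Space m) ℝ,
      Z ≠ 0 → Tendsto (fun n => iteratedFDeriv ℝ j (u n) Z) atTop (𝓝 T) := by
    intro j Z
    by_cases hZ : Z = 0
    · exact ⟨0, fun h => absurd hZ h⟩
    obtain ⟨k, hjk, hk⟩ := exists_shell_mem_nhds j hZ
    obtain ⟨T, hT⟩ := cauchySeq_tendsto_of_complete ((hc j k hjk).cauchySeq (mem_of_mem_nhds hk))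
    exact ⟨T, fun _ => hT⟩
  choose P hP using hl
  have hunif : ∀ j k, j ≤ k → TendstoUniformlyOn (fun n => iteratedFDeriv ℝ j (u n)) (P j) atTop
      (shell m k) := fun j k hjk =>
    (hc j k hjk).tendstoUniformlyOn_of_tendsto fun Z hZ => hP j Z (shell_subset m k hZ)
  have hloc : ∀ j, TendstoLocallyUniformlyOn (fun n => iteratedFDeriv ℝ j (u n)) (P j) atTop
      {0}ᶜ := by
    intro j
    refine tendstoLocallyUniformlyOn_of_forall_exists_nhds fun Z hZ => ?_
    obtain ⟨k, hjk, hk⟩ := exists_shell_mem_nhds j hZ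
    exact ⟨_, mem_nhdsWithin_of_mem_nhds hk, hunif j k hjk⟩
  have hopen : IsOpen ({0}ᶜ : Set (Space m)) := isOpen_compl_singleton
  set g : Space m → ℝ := fun Z => if Z = 0 then 0 else (P 0 Z).curry0 with hg
  -- The limits `P j` form the Taylor series of `g`: each is differentiable with derivative `P (j +
  -- 1)`, by locally uniform convergence of the derivatives.
  have hts : HasFTaylorSeriesUpToOn ∞ g (fun Z j => P j Z) {0}ᶜ := by
    refine ⟨fun Z hZ => (if_neg hZ).symm, fun j _ Z hZ => ?_, fun j _ => ?_⟩
    · refine HasFDerivAt.hasFDerivWithinAt ?_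
      have h1 : TendstoLocallyUniformlyOn
          (fun n Z => (iteratedFDeriv ℝ (j + 1) (u n) Z).curryLeft)
          (fun Z => (P (j + 1) Z).curryLeft) atTop {0}ᶜ := by
        have := (continuousMultilinearCurryLeftEquiv ℝ (fun _ : Fin (j + 1) => Space m)
          ℝ).isometry.uniformContinuous.comp_tendstoLocallyUniformlyOn (hloc (j + 1))
        exact this
      refine hasFDerivAt_of_tendstoLocallyUniformlyOn hopen h1 (fun n x hx => ?_)
        (fun x hx => hP j x hx) hZ
      have h2 : DifferentiableAt ℝ (iteratedFDeriv ℝ j (u n)) x :=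
        ((u n).contDiffAt hx (j + 1)).differentiableAt_iteratedFDeriv
          (by exact_mod_cast j.lt_succ_self)
      have h3 : (iteratedFDeriv ℝ (j + 1) (u n) x).curryLeft =
          fderiv ℝ (iteratedFDeriv ℝ j (u n)) x := by
        rw [iteratedFDeriv_succ_eq_comp_left]
        exact (continuousMultilinearCurryLeftEquiv ℝ (fun _ : Fin (j + 1) => Space m)
          ℝ).apply_symm_apply _
      rw [h3]
      exact h2.hasFDerivAt
    · refine (hloc j).continuousOn (Eventually.frequently (Eventually.of_forall fun n x hx => ?_))
      have := ((u n).contDiffAt hx (j + 1)).differentiableAt_iteratedFDeriv (m := j)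
        (by exact_mod_cast j.lt_succ_self)
      exact this.continuousAt.continuousWithinAt
  have hsm : ContDiffOn ℝ ∞ g {0}ᶜ := hts.contDiffOn
  have hder : ∀ j, ∀ Z ∈ ({0}ᶜ : Set (Space m)), iteratedFDeriv ℝ j g Z = P j Z := by
    intro j Z hZ
    rw [← iteratedFDerivWithin_of_isOpen j hopen hZ]
    exact (hts.eq_iteratedFDerivWithin_of_uniqueDiffOn (by exact_mod_cast le_top)
      hopen.uniqueDiffOn hZ).symm
  obtain ⟨f, hf⟩ : ∃ f : SmoothPunctured m, (f : Space m → ℝ) = g :=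
    ⟨(⟨g, hsm, if_pos rfl⟩ : smoothSubmodule m), rfl⟩
  refine ⟨f, fun k ε hε => ?_⟩
  have h1 : ∀ j ∈ Finset.range (k + 1), ∀ᶠ n in atTop, ∀ Z ∈ shell m k,
      dist (P j Z) (iteratedFDeriv ℝ j (u n) Z) < ε / 2 := fun j hj =>
    Metric.tendstoUniformlyOn_iff.mp
      (hunif j k (Nat.lt_succ_iff.mp (Finset.mem_range.mp hj))) _ (by positivity)
  obtain ⟨N, hN⟩ := eventually_atTop.mp ((Finset.eventually_all _).mpr h1)
  refine ⟨N, fun a ha => (seminorm_le (C := ε / 2) _ fun j hj Z hZ => ?_).trans_lt (by linarith)⟩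
  have hZ0 := shell_subset m k hZ
  rw [iteratedFDeriv_sub_apply' _ _ hZ0]
  have h2 := (hN a ha j (Finset.mem_range.mpr (by omega)) Z hZ).le
  rw [← hder j Z hZ0, ← hf, dist_comm, dist_eq_norm] at h2
  exact h2

/-- Gives the Hausdorff property, and lets evenness and homogeneity pass to limits. -/
theorem eval_continuous {m : ℕ} (Z : Space m) : Continuous fun f : SmoothPunctured m => f Z := by
  by_cases hZ : Z = 0
  · have : (fun f : SmoothPunctured m => f Z) = fun _ => 0 := by
      funext f; rw [hZ]; exact f.map_zero
    rw [this]; exact continuous_const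
  obtain ⟨k, -, hk⟩ := exists_shell_mem_nhds 0 hZ
  have hs := withSeminorms m
  rw [continuous_iff_continuousAt]
  intro f
  rw [ContinuousAt, Metric.tendsto_nhds]
  intro ε hε
  filter_upwards [(hs.tendsto_nhds id f).mp tendsto_id k ε hε] with g hg
  refine lt_of_le_of_lt ?_ hg
  have := norm_iteratedFDeriv_le_seminorm (Nat.zero_le k) (g - f) (mem_of_mem_nhds hk)
  rw [pow_zero, one_mul, norm_iteratedFDeriv_zero] at this
  exact this

/-! ### The Fréchet space structure -/

instance (m : ℕ) : IsTopologicalAddGroup (SmoothPunctured m) :=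
  (withSeminorms m).topologicalAddGroup

instance (m : ℕ) : ContinuousSMul ℝ (SmoothPunctured m) := (withSeminorms m).continuousSMul

instance (m : ℕ) : LocallyConvexSpace ℝ (SmoothPunctured m) :=
  (withSeminorms m).toLocallyConvexSpace

instance (m : ℕ) : FirstCountableTopology (SmoothPunctured m) :=
  (withSeminorms m).firstCountableTopology

instance (m : ℕ) : T2Space (SmoothPunctured m) := by
  refine ⟨fun f g hfg => ?_⟩
  obtain ⟨Z, hZ⟩ : ∃ Z, f Z ≠ g Z := by
    by_contra! h
    exact hfg (SmoothPunctured.ext h)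
  exact separated_by_continuous (eval_continuous Z) hZ

theorem isFrechetSpace_evenHomogeneous (m : ℕ) (q : ℝ) :
    IsFrechetSpace (evenHomogeneous m q) := by
  have hs := withSeminorms m
  refine ⟨inferInstance, inferInstance, ?_, inferInstance,
    Topology.IsInducing.subtypeVal.firstCountableTopology, fun u hu => ?_⟩
  · exact LocallyConvexSpace.induced (evenHomogeneous m q).subtype
  obtain ⟨f, hf⟩ := exists_limit_of_cauchy (fun n => (u n : SmoothPunctured m)) (by
    intro k ε hε
    have hc : Continuous fun x : evenHomogeneous m q => seminorm m k x :=
      (hs.continuous_seminorm k).comp continuous_subtype_val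
    obtain ⟨N, hN⟩ := hu {x | seminorm m k x < ε}
      ((isOpen_lt hc continuous_const).mem_nhds (by simpa using hε))
    exact ⟨N, fun a ha b hb => hN a ha b hb⟩)
  have hlim : Tendsto (fun n => (u n : SmoothPunctured m)) atTop (𝓝 f) :=
    (hs.tendsto_nhds_atTop _ _).mpr fun k ε hε => hf k ε hε
  have hev : ∀ Z, Tendsto (fun n => (u n : SmoothPunctured m) Z) atTop (𝓝 (f Z)) := fun Z =>
    ((eval_continuous Z).tendsto f).comp hlim
  refine ⟨⟨f, fun y => ?_, fun t ht y hy => ?_⟩, tendsto_subtype_rng.mpr hlim⟩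
  · refine tendsto_nhds_unique (hev (-y)) ((hev y).congr fun n => ((u n).2.1 y).symm)
  · exact tendsto_nhds_unique (hev (t • y))
      (((hev y).const_mul (t ^ q)).congr fun n => ((u n).2.2 t ht y hy).symm)

/-! ### Radial cutoff -/

/-- A bump function of one variable, supported where `1 < r ^ 2 < 3`. -/
def radialBump (r : ℝ) : ℝ :=
  (⟨1 / 2, 1, by norm_num, by norm_num⟩ : ContDiffBump (2 : ℝ)) (r ^ 2)

/-- The radial cutoff function. -/
def cutoff (m : ℕ) (x : Space m) : ℝ := radialBump ‖x‖

theorem radialBump_nonneg (r : ℝ) : 0 ≤ radialBump r := ContDiffBump.nonneg _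

theorem radialBump_continuous : Continuous radialBump :=
  (ContDiffBump.continuous _).comp (continuous_pow 2)

theorem of_radialBump_ne_zero {r : ℝ} (h : radialBump r ≠ 0) : 1 < r ^ 2 ∧ r ^ 2 < 3 := by
  have h1 : r ^ 2 ∈ Metric.ball (2 : ℝ) 1 := by
    have := (ContDiffBump.support_eq (⟨1 / 2, 1, by norm_num, by norm_num⟩ : ContDiffBump (2 : ℝ)))
    rw [← this]
    exact h
  rw [Metric.mem_ball, Real.dist_eq, abs_lt] at h1
  constructor <;> linarith

theorem radialBump_pos {r : ℝ} (h : 1 < r ^ 2) (h' : r ^ 2 < 3) : 0 < radialBump r := by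
  refine ContDiffBump.pos_of_mem_ball _ ?_
  rw [Metric.mem_ball, Real.dist_eq, abs_lt]
  constructor <;> linarith

theorem cutoff_contDiff (m : ℕ) : ContDiff ℝ ∞ (cutoff m) :=
  (ContDiffBump.contDiff _).comp (contDiff_norm_sq ℝ)

theorem support_cutoff_subset (m : ℕ) : Function.support (cutoff m) ⊆ shell m 1 := by
  intro x hx
  obtain ⟨h1, h2⟩ := of_radialBump_ne_zero hx
  have h0 := norm_nonneg x
  refine ⟨?_, ?_⟩
  · simp only [Metric.mem_closedBall, dist_zero_right]
    push_cast
    nlinarith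
  · simp only [Metric.mem_ball, dist_zero_right, not_lt]
    push_cast
    nlinarith

theorem tsupport_cutoff_subset (m : ℕ) : tsupport (cutoff m) ⊆ shell m 1 :=
  closure_minimal (support_cutoff_subset m) (isCompact_shell m 1).isClosed

theorem shell_one_subset {m k : ℕ} (hk : 1 ≤ k) : shell m 1 ⊆ shell m k := by
  have hk' : (1 : ℝ) ≤ k := by exact_mod_cast hk
  refine sdiff_subset_sdiff (Metric.closedBall_subset_closedBall ?_) (Metric.ball_subset_ball ?_)
  · push_cast; linarith
  · push_cast
    exact one_div_le_one_div_of_le (by norm_num) (by linarith)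

theorem cutoff_mul_contDiff {m : ℕ} (f : SmoothPunctured m) :
    ContDiff ℝ ∞ fun x => cutoff m x * f x := by
  rw [contDiff_iff_contDiffAt]
  intro x
  by_cases hx : x = 0
  · have h0 : x ∉ tsupport (cutoff m) := fun h => shell_subset m 1 (tsupport_cutoff_subset m h) hx
    have h1 : (fun x => cutoff m x * f x) =ᶠ[𝓝 x] fun _ => 0 := by
      filter_upwards [notMem_tsupport_iff_eventuallyEq.mp h0] with y hy
      simp [hy]
    exact contDiffAt_const.congr_of_eventuallyEq h1
  · exact (cutoff_contDiff m).contDiffAt.mul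
      (f.2.1.contDiffAt (isOpen_compl_singleton.mem_nhds hx))

theorem cutoff_hasCompactSupport (m : ℕ) : HasCompactSupport (cutoff m) :=
  (isCompact_shell m 1).of_isClosed_subset (isClosed_tsupport _) (tsupport_cutoff_subset m)

/-- The cutoff function as a Schwartz function. -/
def cutoffSchwartz (m : ℕ) : 𝓢(Space m, ℝ) :=
  (cutoff_hasCompactSupport m).toSchwartzMap (cutoff_contDiff m)

/-- Multiplication by the cutoff function, as a linear map into the Schwartz space. -/
def cutoffLM (m : ℕ) : SmoothPunctured m →ₗ[ℝ] 𝓢(Space m, ℝ) where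
  toFun f := (cutoff_hasCompactSupport m).mul_right.toSchwartzMap (cutoff_mul_contDiff f)
  map_add' f g := SchwartzMap.ext fun x => mul_add (cutoff m x) (f x) (g x)
  map_smul' c f := SchwartzMap.ext fun x => mul_left_comm (cutoff m x) c (f x)

/-- Leibniz rule on `shell m 1`, which contains the support of the cutoff; all derivatives vanish
elsewhere. The index `max b 1` provides both enough derivatives and a shell containing `shell m 1`.
-/
theorem cutoffLM_bound (m a b : ℕ) : ∃ C : ℝ, 0 ≤ C ∧ ∀ (f : SmoothPunctured m) (x : Space m),
    ‖x‖ ^ a * ‖iteratedFDeriv ℝ b (cutoffLM m f) x‖ ≤ C * seminorm m (max b 1) f := by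
  set D : ℝ := ∑ i ∈ Finset.range (b + 1), (b.choose i : ℝ) *
    SchwartzMap.seminorm ℝ 0 i (cutoffSchwartz m) * ((m : ℝ) + 1) ^ (b - i) with hD
  have hD0 : 0 ≤ D := Finset.sum_nonneg fun i _ =>
    mul_nonneg (mul_nonneg (Nat.cast_nonneg _) (apply_nonneg _ _)) (by positivity)
  refine ⟨2 ^ a * D, by positivity, fun f x => ?_⟩
  have hs0 : 0 ≤ seminorm m (max b 1) f := apply_nonneg _ _
  by_cases hx : x ∈ shell m 1
  · have hx0 : x ∈ ({0}ᶜ : Set (Space m)) := shell_subset m 1 hx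
    have h1 : ‖x‖ ^ a ≤ 2 ^ a := by
      refine pow_le_pow_left₀ (norm_nonneg _) ?_ a
      have := hx.1
      simp only [Metric.mem_closedBall, dist_zero_right] at this
      push_cast at this
      linarith
    have h2 : ‖iteratedFDeriv ℝ b (cutoffLM m f) x‖ ≤ D * seminorm m (max b 1) f := by
      have hopen : IsOpen ({0}ᶜ : Set (Space m)) := isOpen_compl_singleton
      have := norm_iteratedFDerivWithin_mul_le (𝕜 := ℝ) (N := ∞) (n := b)
        (cutoff_contDiff m).contDiffOn f.2.1 hopen.uniqueDiffOn hx0 (by exact_mod_cast le_top)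
      simp only [iteratedFDerivWithin_of_isOpen _ hopen hx0] at this
      refine this.trans ?_
      rw [hD, Finset.sum_mul]
      refine Finset.sum_le_sum fun i _ => ?_
      rw [mul_assoc _ (_ ^ _)]
      refine mul_le_mul (mul_le_mul_of_nonneg_left ?_ (Nat.cast_nonneg _)) ?_ (norm_nonneg _)
        (mul_nonneg (Nat.cast_nonneg _) (apply_nonneg _ _))
      · exact SchwartzMap.norm_iteratedFDeriv_le_seminorm ℝ (cutoffSchwartz m) i x
      · exact norm_iteratedFDeriv_le_seminorm ((Nat.sub_le _ _).trans (le_max_left _ _)) f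
          (shell_one_subset (le_max_right _ _) hx)
    rw [mul_assoc]
    exact mul_le_mul h1 h2 (norm_nonneg _) (by positivity)
  · have h1 : x ∉ tsupport (cutoffLM m f) := fun h => hx
      (tsupport_cutoff_subset m (tsupport_mul_subset_left h))
    have h2 : iteratedFDeriv ℝ b (cutoffLM m f) x = 0 := by
      by_contra h
      exact h1 (support_iteratedFDeriv_subset b h)
    rw [h2, norm_zero, mul_zero]
    positivity

/-- Multiplication by the cutoff function, as a continuous linear map into the Schwartz space. -/
def cutoffCLM (m : ℕ) : SmoothPunctured m →L[ℝ] 𝓢(Space m, ℝ) where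
  toLinearMap := cutoffLM m
  cont := by
    refine WithSeminorms.continuous_of_isBounded (withSeminorms m)
      (schwartz_withSeminorms ℝ (Space m) ℝ) _ (Seminorm.IsBounded.of_real fun n => ?_)
    obtain ⟨C, hC, h⟩ := cutoffLM_bound m n.1 n.2
    refine ⟨{max n.2 1}, C, fun f => ?_⟩
    rw [Finset.sup_singleton]
    exact (cutoffLM m f).seminorm_le_bound ℝ n.1 n.2 (mul_nonneg hC (apply_nonneg _ _)) (h f)

theorem cutoffCLM_apply {m : ℕ} (f : SmoothPunctured m) (x : Space m) :
    cutoffCLM m f x = cutoff m x * f x := rfl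

/-! ### Weighted integrals along rays -/

/-- The weighted ray integral `x ↦ ∫ s in (0, ∞), s ^ p • h (s • x)`. -/
def rayIntegral {E V : Type*} [NormedAddCommGroup E] [NormedSpace ℝ E] [NormedAddCommGroup V]
    [NormedSpace ℝ V] (p : ℕ) (h : E → V) (x : E) : V :=
  ∫ s in Ioi (0 : ℝ), s ^ p • h (s • x)

section Ray

variable {E V : Type} [NormedAddCommGroup E] [NormedSpace ℝ E] [NormedAddCommGroup V]
  [NormedSpace ℝ V]

/-- Of the `p + 2` powers of decay, `p` absorb the weight `s ^ p` and two leave an integrable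
majorant, uniform in `‖x‖ ≥ r`. -/
theorem norm_ray_le {p : ℕ} {h : E → V} {S : ℝ} (hS : ∀ y, (1 + ‖y‖) ^ (p + 2) * ‖h y‖ ≤ S)
    {r : ℝ} (hr : 0 < r) {x : E} (hx : r ≤ ‖x‖) {s : ℝ} (hs : 0 < s) :
    ‖s ^ p • h (s • x)‖ ≤ (r ^ p)⁻¹ * S * (1 + (r * s) ^ 2)⁻¹ := by
  have hn : ‖s • x‖ = s * ‖x‖ := by rw [norm_smul, Real.norm_of_nonneg hs.le]
  have h1 : r * s ≤ ‖s • x‖ := by rw [hn, mul_comm]; exact mul_le_mul_of_nonneg_left hx hs.le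
  have hrs : 0 ≤ r * s := by positivity
  have h2 : (r * s) ^ p * (1 + (r * s) ^ 2) ≤ (1 + ‖s • x‖) ^ (p + 2) := by
    rw [pow_add]
    refine mul_le_mul (pow_le_pow_left₀ hrs (by linarith) p) ?_ (by positivity) (by positivity)
    nlinarith
  have h3 : (r * s) ^ p * (1 + (r * s) ^ 2) * ‖h (s • x)‖ ≤ S :=
    (mul_le_mul_of_nonneg_right h2 (norm_nonneg _)).trans (hS _)
  rw [norm_smul, norm_pow, Real.norm_of_nonneg hs.le, ← div_eq_mul_inv, le_div_iff₀ (by positivity),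
    inv_mul_eq_div, le_div_iff₀ (by positivity)]
  rw [mul_pow] at h3
  linarith

theorem integrable_ray_bound (c : ℝ) {r : ℝ} (hr : 0 < r) :
    Integrable (fun s : ℝ => c * (1 + (r * s) ^ 2)⁻¹) (volume.restrict (Ioi 0)) :=
  ((integrable_inv_one_add_sq.comp_mul_left' hr.ne').const_mul c).integrableOn

theorem exists_decay (h : 𝓢(E, V)) (k j : ℕ) :
    ∃ S : ℝ, ∀ y, (1 + ‖y‖) ^ k * ‖iteratedFDeriv ℝ j h y‖ ≤ S :=
  ⟨_, fun y => one_add_le_sup_seminorm_apply (𝕜 := ℝ) (m := (k, j)) le_rfl le_rfl h y⟩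

theorem exists_decay_zero (h : 𝓢(E, V)) (k : ℕ) :
    ∃ S : ℝ, ∀ y, (1 + ‖y‖) ^ k * ‖h y‖ ≤ S := by
  simpa using exists_decay h k 0

theorem continuous_ray (p : ℕ) (h : 𝓢(E, V)) (x : E) :
    Continuous fun s : ℝ => s ^ p • h (s • x) :=
  (continuous_pow p).smul (h.continuous.comp (continuous_id.smul continuous_const))

theorem integrable_ray (p : ℕ) (h : 𝓢(E, V)) {x : E} (hx : x ≠ 0) :
    Integrable (fun s : ℝ => s ^ p • h (s • x)) (volume.restrict (Ioi 0)) := by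
  obtain ⟨S, hS⟩ := exists_decay_zero h (p + 2)
  refine (integrable_ray_bound ((‖x‖ ^ p)⁻¹ * S) (norm_pos_iff.mpr hx)).mono'
    (continuous_ray p h x).aestronglyMeasurable ?_
  exact (ae_restrict_iff' measurableSet_Ioi).mpr
    (Eventually.of_forall fun s hs => norm_ray_le hS (norm_pos_iff.mpr hx) le_rfl hs)

/-- Differentiation under the integral sign: the chain rule yields a factor `s`, so the derivative
is again a ray integral, with weight `p + 1` and the Schwartz function `fderiv h`. This drives the
inductions below, which therefore range over all target spaces `V`. -/
theorem hasFDerivAt_rayIntegral (p : ℕ) (h : 𝓢(E, V)) {x : E} (hx : x ≠ 0) :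
    HasFDerivAt (rayIntegral p h) (rayIntegral (p + 1) (fderivCLM ℝ E V h) x) x := by
  have hx' : 0 < ‖x‖ / 2 := by have := norm_pos_iff.mpr hx; positivity
  obtain ⟨S, hS⟩ := exists_decay_zero (fderivCLM ℝ E V h) (p + 1 + 2)
  refine hasFDerivAt_integral_of_dominated_of_fderiv_le (s := {y | ‖x‖ / 2 < ‖y‖})
    (F := fun y s => s ^ p • h (s • y))
    (F' := fun y s => s ^ (p + 1) • fderivCLM ℝ E V h (s • y))
    (bound := fun s => ((‖x‖ / 2) ^ (p + 1))⁻¹ * S * (1 + (‖x‖ / 2 * s) ^ 2)⁻¹) ?_ ?_ ?_ ?_ ?_ ?_ ?_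
  · exact (isOpen_lt continuous_const continuous_norm).mem_nhds (by
      change ‖x‖ / 2 < ‖x‖; linarith)
  · exact Eventually.of_forall fun y => (continuous_ray p h y).aestronglyMeasurable
  · exact integrable_ray p h hx
  · exact (continuous_ray (p + 1) (fderivCLM ℝ E V h) x).aestronglyMeasurable
  · exact (ae_restrict_iff' measurableSet_Ioi).mpr
      (Eventually.of_forall fun s hs y hy => norm_ray_le hS hx' (le_of_lt hy) hs)
  · exact integrable_ray_bound _ hx'
  · refine Eventually.of_forall fun s y _ => ?_
    have h1 : HasFDerivAt (fun y : E => s • y) (s • ContinuousLinearMap.id ℝ E) y :=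
      (hasFDerivAt_id y).const_smul s
    have h2 := ((h.hasFDerivAt (s • y)).comp y h1).const_smul (s ^ p)
    have h3 : s ^ (p + 1) • fderivCLM ℝ E V h (s • y) =
        s ^ p • (fderiv ℝ h (s • y)).comp (s • ContinuousLinearMap.id ℝ E) := by
      rw [ContinuousLinearMap.comp_smul, ContinuousLinearMap.comp_id, smul_smul, pow_succ,
        fderivCLM_apply]
    rw [h3]
    exact h2

theorem rayIntegral_contDiffOn_nat (n : ℕ) : ∀ {V : Type} [NormedAddCommGroup V] [NormedSpace ℝ V]
    (p : ℕ) (h : 𝓢(E, V)), ContDiffOn ℝ n (rayIntegral p h) {0}ᶜ := by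
  induction n with
  | zero =>
    intro V _ _ p h
    refine contDiffOn_zero.mpr fun x hx => ?_
    exact (hasFDerivAt_rayIntegral p h hx).continuousAt.continuousWithinAt
  | succ n ih =>
    intro V _ _ p h
    push_cast
    refine (contDiffOn_succ_iff_fderiv_of_isOpen isOpen_compl_singleton).mpr ⟨fun x hx =>
      (hasFDerivAt_rayIntegral p h hx).differentiableAt.differentiableWithinAt, ?_, ?_⟩
    · intro h; exact absurd h (by exact_mod_cast WithTop.coe_ne_top)
    · exact (ih (p + 1) (fderivCLM ℝ E V h)).congr fun x hx =>
        (hasFDerivAt_rayIntegral p h hx).fderiv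

theorem rayIntegral_contDiffOn (p : ℕ) (h : 𝓢(E, V)) :
    ContDiffOn ℝ ∞ (rayIntegral p h) {0}ᶜ :=
  contDiffOn_infty.mpr fun n => rayIntegral_contDiffOn_nat n p h

theorem norm_iteratedFDeriv_rayIntegral_le (j : ℕ) :
    ∀ {V : Type} [NormedAddCommGroup V] [NormedSpace ℝ V] (p : ℕ) (h : 𝓢(E, V)) {S : ℝ}
    (_ : ∀ y, (1 + ‖y‖) ^ (p + j + 2) * ‖iteratedFDeriv ℝ j h y‖ ≤ S) {r : ℝ} (_ : 0 < r) {x : E}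
    (_ : r ≤ ‖x‖), ‖iteratedFDeriv ℝ j (rayIntegral p h) x‖ ≤
      (r ^ (p + j))⁻¹ * S * ∫ s in Ioi (0 : ℝ), (1 + (r * s) ^ 2)⁻¹ := by
  induction j with
  | zero =>
    intro V _ _ p h S hS r hr x hx
    rw [norm_iteratedFDeriv_zero, ← integral_const_mul]
    refine norm_integral_le_of_norm_le (integrable_ray_bound _ hr) ?_
    exact (ae_restrict_iff' measurableSet_Ioi).mpr (Eventually.of_forall fun s hs =>
      norm_ray_le (fun y => by simpa using hS y) hr hx hs)
  | succ j ih =>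
    intro V _ _ p h S hS r hr x hx
    have hx0 : x ≠ 0 := norm_pos_iff.mp (hr.trans_le hx)
    have h1 : fderiv ℝ (rayIntegral p h) =ᶠ[𝓝 x]
        rayIntegral (p + 1) (fderivCLM ℝ E V h) := by
      filter_upwards [isOpen_compl_singleton.mem_nhds hx0] with y hy
      exact (hasFDerivAt_rayIntegral p h hy).fderiv
    rw [← norm_iteratedFDeriv_fderiv, (h1.iteratedFDeriv ℝ j).eq_of_nhds,
      show p + (j + 1) = p + 1 + j by ring]
    refine ih (p + 1) (fderivCLM ℝ E V h) (fun y => ?_) hr hx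
    have h2 : (fderivCLM ℝ E V h : E → E →L[ℝ] V) = fderiv ℝ h := rfl
    rw [h2, norm_iteratedFDeriv_fderiv, show p + 1 + j + 2 = p + (j + 1) + 2 by ring]
    exact hS y

/-- At the origin the integrand is a constant times the non-integrable `s ^ p`, and the default
value `0` of the integral agrees with the convention for `SmoothPunctured`. -/
theorem rayIntegral_zero (p : ℕ) (h : E → ℝ) : rayIntegral p h 0 = 0 := by
  unfold rayIntegral
  simp only [smul_zero, smul_eq_mul]
  rw [integral_mul_const, integral_undef, zero_mul]
  have := not_integrableOn_Ioi_rpow (p : ℝ)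
  simpa [IntegrableOn] using this

theorem rayIntegral_add (p : ℕ) (f g : 𝓢(E, V)) {x : E} (hx : x ≠ 0) :
    rayIntegral p (⇑(f + g)) x = rayIntegral p f x + rayIntegral p g x := by
  unfold rayIntegral
  rw [← integral_add (integrable_ray p f hx) (integrable_ray p g hx)]
  simp only [_root_.add_apply, smul_add]

theorem rayIntegral_const_smul (p : ℕ) (c : ℝ) (f : E → V) (x : E) :
    rayIntegral p (c • f) x = c • rayIntegral p f x := by
  unfold rayIntegral
  rw [← integral_smul]
  simp only [Pi.smul_apply, smul_comm c]

theorem rayIntegral_neg_of_even (p : ℕ) {h : E → V} (hh : ∀ x, h (-x) = h x) (x : E) :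
    rayIntegral p h (-x) = rayIntegral p h x := by
  unfold rayIntegral
  simp only [smul_neg, hh]

theorem rayIntegral_smul (p : ℕ) (h : E → V) {t : ℝ} (ht : 0 < t) (x : E) :
    rayIntegral p h (t • x) = t ^ (-((p : ℝ) + 1)) • rayIntegral p h x := by
  unfold rayIntegral
  have h1 := integral_comp_mul_right_Ioi (fun s => s ^ p • h (s • x)) 0 ht
  rw [zero_mul] at h1
  have h2 : ∀ s : ℝ, s ^ p • h (s • t • x) = (t ^ p)⁻¹ • ((s * t) ^ p • h ((s * t) • x)) := by
    intro s
    rw [smul_smul, smul_smul, mul_pow]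
    congr 1
    field_simp
  simp_rw [h2]
  rw [integral_smul, h1, smul_smul, Real.rpow_neg ht.le, Real.rpow_add_one ht.ne', mul_inv,
    Real.rpow_natCast]

end Ray

/-- The weighted ray integral of a Schwartz function, as a smooth function on the punctured
space. -/
def rayLM (m p : ℕ) : 𝓢(Space m, ℝ) →ₗ[ℝ] SmoothPunctured m where
  toFun h := (⟨rayIntegral p h, rayIntegral_contDiffOn p h, rayIntegral_zero p h⟩ :
    smoothSubmodule m)
  map_add' f g := SmoothPunctured.ext fun x => by
    change rayIntegral p (⇑(f + g)) x = rayIntegral p f x + rayIntegral p g x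
    by_cases hx : x = 0
    · simp only [hx, rayIntegral_zero, add_zero]
    · exact rayIntegral_add p f g hx
  map_smul' c f := SmoothPunctured.ext fun x => rayIntegral_const_smul p c f x

theorem rayLM_bound (m p k : ℕ) : ∃ (s : Finset (ℕ × ℕ)) (C : ℝ), ∀ h : 𝓢(Space m, ℝ),
    seminorm m k (rayLM m p h) ≤ C * s.sup (schwartzSeminormFamily ℝ (Space m) ℝ) h := by
  set r : ℝ := 1 / ((k : ℝ) + 1) with hr
  have hr0 : 0 < r := by positivity
  set J : ℝ := ∫ s in Ioi (0 : ℝ), (1 + (r * s) ^ 2)⁻¹ with hJ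
  have hJ0 : 0 ≤ J := integral_nonneg fun s => by positivity
  set D : ℝ := ∑ j ∈ Finset.range (k + 1), (r ^ (p + j))⁻¹ with hD
  refine ⟨Finset.Iic (p + k + 2, k), D * 2 ^ (p + k + 2) * J, fun h => ?_⟩
  refine seminorm_le _ fun j hj Z hZ => ?_
  have hZ' : r ≤ ‖Z‖ := by simpa [hr] using hZ.2
  set Q := (Finset.Iic (p + k + 2, k)).sup (schwartzSeminormFamily ℝ (Space m) ℝ) h with hQ
  have hQ0 : 0 ≤ Q := apply_nonneg _ _
  have h1 := norm_iteratedFDeriv_rayIntegral_le j p h (S := 2 ^ (p + k + 2) * Q) (fun y =>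
    one_add_le_sup_seminorm_apply (𝕜 := ℝ) (m := (p + k + 2, k)) (by simp; omega) hj h y) hr0 hZ'
  refine h1.trans ?_
  have h2 : (r ^ (p + j))⁻¹ ≤ D := Finset.single_le_sum (f := fun j => (r ^ (p + j))⁻¹)
    (fun _ _ => by positivity) (Finset.mem_range.mpr (by omega))
  calc (r ^ (p + j))⁻¹ * (2 ^ (p + k + 2) * Q) * J ≤ D * (2 ^ (p + k + 2) * Q) * J := by gcongr
    _ = _ := by ring

/-- The weighted ray integral, as a continuous linear map from the Schwartz space. -/
def rayCLM (m p : ℕ) : 𝓢(Space m, ℝ) →L[ℝ] SmoothPunctured m where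
  toLinearMap := rayLM m p
  cont := WithSeminorms.continuous_of_isBounded (schwartz_withSeminorms ℝ (Space m) ℝ)
    (withSeminorms m) _ (Seminorm.IsBounded.of_real fun k => rayLM_bound m p k)

/-! ### The cosine transform on even Schwartz functions -/

section Cosine

variable {E : Type} [NormedAddCommGroup E] [InnerProductSpace ℝ E] [FiniteDimensional ℝ E]
  [MeasurableSpace E] [BorelSpace E]

variable (E) in
/-- The real part of the Fourier transform of a real Schwartz function. -/
def cosTransform : 𝓢(E, ℝ) →L[ℝ] 𝓢(E, ℝ) :=
  (postcompCLM Complex.reCLM).comp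
    ((fourierTransformCLM ℝ).comp (postcompCLM Complex.ofRealCLM))

theorem cosTransform_apply (h : 𝓢(E, ℝ)) (ξ : E) :
    cosTransform E h ξ = (𝓕 (fun x => (h x : ℂ)) ξ).re := rfl

theorem integrable_ofReal (h : 𝓢(E, ℝ)) : Integrable fun x => (h x : ℂ) :=
  h.integrable.ofReal

theorem fourier_neg_of_even {h : E → ℂ} (hh : ∀ x, h (-x) = h x) (ξ : E) :
    𝓕 h (-ξ) = 𝓕 h ξ := by
  rw [← Real.fourierInv_eq_fourier_neg, Real.fourierInv_eq_fourier_comp_neg]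
  simp only [hh]

theorem cosTransform_even {h : 𝓢(E, ℝ)} (hh : ∀ x, h (-x) = h x) (ξ : E) :
    cosTransform E h (-ξ) = cosTransform E h ξ := by
  rw [cosTransform_apply, cosTransform_apply, fourier_neg_of_even]
  simp [hh]

theorem conj_fourier_ofReal (h : E → ℝ) (ξ : E) :
    (starRingEnd ℂ) (𝓕 (fun x => (h x : ℂ)) ξ) = 𝓕 (fun x => (h x : ℂ)) (-ξ) := by
  rw [Real.fourier_eq, Real.fourier_eq, ← integral_conj]
  refine integral_congr_ae (Eventually.of_forall fun x => ?_)
  simp only [Circle.smul_def, smul_eq_mul, map_mul, Complex.conj_ofReal, inner_neg_right]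
  rw [← Circle.coe_inv_eq_conj, ← AddChar.map_neg_eq_inv]

/-- Conjugating the transform of a real function reflects its argument, so evenness makes it real.
-/
theorem ofReal_cosTransform {h : 𝓢(E, ℝ)} (hh : ∀ x, h (-x) = h x) (ξ : E) :
    (cosTransform E h ξ : ℂ) = 𝓕 (fun x => (h x : ℂ)) ξ := by
  rw [cosTransform_apply]
  refine Complex.conj_eq_iff_re.mp ?_
  rw [conj_fourier_ofReal, fourier_neg_of_even]
  simp [hh]

theorem cosTransform_cosTransform {h : 𝓢(E, ℝ)} (hh : ∀ x, h (-x) = h x) :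
    cosTransform E (cosTransform E h) = h := by
  ext ξ
  have h1 : (fun x => (cosTransform E h x : ℂ)) = 𝓕 (fun x => (h x : ℂ)) :=
    funext fun x => ofReal_cosTransform hh x
  have h2 : 𝓕⁻ (𝓕 (postcompCLM Complex.ofRealCLM h : 𝓢(E, ℂ))) =
      postcompCLM Complex.ofRealCLM h := fourierInv_fourier_eq _
  have h3 := DFunLike.congr_fun h2 (-ξ)
  rw [fourierInv_coe, Real.fourierInv_eq_fourier_neg, neg_neg, fourier_coe] at h3
  rw [cosTransform_apply, h1]
  have h4 : 𝓕 (𝓕 (fun x => (h x : ℂ))) ξ = (h (-ξ) : ℂ) := h3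
  rw [h4, hh, Complex.ofReal_re]

/-- Self-adjointness of the Fourier integral with respect to the symmetric form `s ⟪x, y⟫`, followed
by taking real parts. -/
theorem integral_cosTransform_smul_mul (h u : 𝓢(E, ℝ)) (s : ℝ) :
    ∫ x, cosTransform E h (s • x) * u x = ∫ y, h y * cosTransform E u (s • y) := by
  have key := VectorFourier.integral_fourierIntegral_smul_eq_flip (μ := (volume : Measure E))
    (ν := (volume : Measure E)) (L := s • innerₗ E) (e := Real.fourierChar)
    (f := fun x => (h x : ℂ)) (g := fun x => (u x : ℂ)) Real.continuous_fourierChar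
    (continuous_const.mul (continuous_inner (𝕜 := ℝ) (E := E))) (integrable_ofReal h)
    (integrable_ofReal u)
  have h1 : ∀ (g : E → ℂ) (x : E), VectorFourier.fourierIntegral Real.fourierChar volume
      (s • innerₗ E) g x = 𝓕 g (s • x) := by
    intro g x
    rw [Real.fourier_eq, VectorFourier.fourierIntegral]
    simp [inner_smul_right]
  have h2 : (s • innerₗ E).flip = s • innerₗ E := by
    ext x y
    simp [real_inner_comm]
  rw [h2] at key
  simp only [h1, smul_eq_mul] at key
  have hb : ∀ g : 𝓢(E, ℝ), ∃ C, ∀ x, ‖𝓕 (fun y => (g y : ℂ)) (s • x)‖ ≤ C := by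
    intro g
    refine ⟨SchwartzMap.seminorm ℝ 0 0 (𝓕 (postcompCLM Complex.ofRealCLM g : 𝓢(E, ℂ))),
      fun x => ?_⟩
    exact SchwartzMap.norm_le_seminorm ℝ (𝓕 (postcompCLM Complex.ofRealCLM g : 𝓢(E, ℂ))) _
  have hcont : ∀ g : 𝓢(E, ℝ), Continuous fun x => 𝓕 (fun y => (g y : ℂ)) (s • x) := fun g =>
    (𝓕 (postcompCLM Complex.ofRealCLM g : 𝓢(E, ℂ))).continuous.comp (continuous_const_smul s)
  obtain ⟨C, hC⟩ := hb h
  obtain ⟨D, hD⟩ := hb u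
  have hi1 : Integrable fun x => 𝓕 (fun y => (h y : ℂ)) (s • x) * (u x : ℂ) :=
    (integrable_ofReal u).bdd_mul (hcont h).aestronglyMeasurable (Eventually.of_forall hC)
  have hi2 : Integrable fun x => (h x : ℂ) * 𝓕 (fun y => (u y : ℂ)) (s • x) :=
    (integrable_ofReal h).mul_bdd (hcont u).aestronglyMeasurable (Eventually.of_forall hD)
  have key2 := congrArg Complex.re key
  rw [← RCLike.re_eq_complex_re, ← integral_re hi1, ← integral_re hi2] at key2
  simpa [cosTransform_apply] using key2

/-! ### Duality of the ray integrals under the cosine transform -/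

/-- The correlation `∫ a (s • x) * u x dx` decays in `s` like `s ^ (-dim E)`. -/
theorem integral_norm_smul_mul_le (a u : 𝓢(E, ℝ)) : ∃ C : ℝ, 0 ≤ C ∧ ∀ s : ℝ, 0 < s →
    ∫ x, ‖a (s • x) * u x‖ ≤ C ∧
    ∫ x, ‖a (s • x) * u x‖ ≤ C * (s ^ Module.finrank ℝ E)⁻¹ := by
  set A := SchwartzMap.seminorm ℝ 0 0 a
  set U := SchwartzMap.seminorm ℝ 0 0 u
  have hA : ∀ x, ‖a x‖ ≤ A := SchwartzMap.norm_le_seminorm ℝ a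
  have hU : ∀ x, ‖u x‖ ≤ U := SchwartzMap.norm_le_seminorm ℝ u
  have hA0 : 0 ≤ A := apply_nonneg _ _
  have hU0 : 0 ≤ U := apply_nonneg _ _
  have hIu : 0 ≤ ∫ x, ‖u x‖ := integral_nonneg fun _ => norm_nonneg _
  have hIa : 0 ≤ ∫ x, ‖a x‖ := integral_nonneg fun _ => norm_nonneg _
  refine ⟨A * (∫ x, ‖u x‖) + U * ∫ x, ‖a x‖, by positivity, fun s hs => ⟨?_, ?_⟩⟩
  · have h0 : ∫ x, ‖a (s • x) * u x‖ ≤ ∫ x, A * ‖u x‖ := by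
      refine integral_mono_of_nonneg (Eventually.of_forall fun _ => norm_nonneg _)
        (u.integrable.norm.const_mul A) (Eventually.of_forall fun x => ?_)
      simp only [norm_mul]
      exact mul_le_mul_of_nonneg_right (hA _) (norm_nonneg _)
    rw [integral_const_mul] at h0
    have : 0 ≤ U * ∫ x, ‖a x‖ := by positivity
    linarith
  · have h1 : Integrable fun x => ‖a (s • x)‖ := (a.integrable.comp_smul hs.ne').norm
    have h0 : ∫ x, ‖a (s • x) * u x‖ ≤ ∫ x, U * ‖a (s • x)‖ := by
      refine integral_mono_of_nonneg (Eventually.of_forall fun _ => norm_nonneg _)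
        (h1.const_mul U) (Eventually.of_forall fun x => ?_)
      simp only [norm_mul]
      rw [mul_comm]
      exact mul_le_mul_of_nonneg_right (hU _) (norm_nonneg _)
    rw [integral_const_mul, Measure.integral_comp_smul_of_nonneg volume (fun x => ‖a x‖) s
      (hR := hs.le), smul_eq_mul] at h0
    have h2 : 0 ≤ A * (∫ x, ‖u x‖) * (s ^ Module.finrank ℝ E)⁻¹ := by positivity
    linarith

/-- Needed for Fubini. Near `s = 0` the inner integral is bounded; at infinity it is `O(s ^
(-dim))`, and `p + 2 ≤ dim` leaves at most `s ^ (-2)`. -/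
theorem integrable_prod_ray {p : ℕ} (hp : p + 2 ≤ Module.finrank ℝ E) (a u : 𝓢(E, ℝ)) :
    Integrable (fun z : ℝ × E => z.1 ^ p * (a (z.1 • z.2) * u z.2))
      ((volume.restrict (Ioi (0 : ℝ))).prod volume) := by
  have hcont : Continuous fun z : ℝ × E => z.1 ^ p * (a (z.1 • z.2) * u z.2) :=
    (continuous_fst.pow p).mul ((a.continuous.comp (continuous_fst.smul continuous_snd)).mul
      (u.continuous.comp continuous_snd))
  refine (integrable_prod_iff hcont.aestronglyMeasurable).mpr ⟨?_, ?_⟩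
  · refine Eventually.of_forall fun s => ?_
    refine Integrable.const_mul (f := fun x => a (s • x) * u x) ?_ (s ^ p)
    exact u.integrable.bdd_mul (a.continuous.comp (continuous_const_smul s)).aestronglyMeasurable
      (Eventually.of_forall fun x => SchwartzMap.norm_le_seminorm ℝ a (s • x))
  · obtain ⟨C, hC0, hC⟩ := integral_norm_smul_mul_le a u
    -- The factor `2` covers both ranges: `1 + s ^ 2 ≤ 2` for `s ≤ 1` and `1 + s ^ 2 ≤ 2 * s ^ 2`
    -- for `s ≥ 1`.
    refine Integrable.mono' (integrable_inv_one_add_sq.const_mul (2 * C)).integrableOn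
      hcont.norm.aestronglyMeasurable.integral_prod_right' ?_
    refine (ae_restrict_iff' measurableSet_Ioi).mpr (Eventually.of_forall fun s hs => ?_)
    have hs' : (0 : ℝ) < s := hs
    obtain ⟨h1, h2⟩ := hC s hs'
    have h3 : ∀ x, ‖s ^ p * (a (s • x) * u x)‖ = s ^ p * ‖a (s • x) * u x‖ := fun x => by
      rw [norm_mul, norm_pow, Real.norm_of_nonneg hs'.le]
    simp only [h3]
    rw [integral_const_mul, Real.norm_of_nonneg (mul_nonneg (by positivity)
      (integral_nonneg fun _ => norm_nonneg _)), ← div_eq_mul_inv, le_div_iff₀ (by positivity)]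
    set I := ∫ x, ‖a (s • x) * u x‖
    have hI : 0 ≤ I := integral_nonneg fun _ => norm_nonneg _
    rcases le_total s 1 with h | h
    · have h4 : s ^ p ≤ 1 := pow_le_one₀ hs'.le h
      have h5 : s ^ p * I ≤ 1 * C := mul_le_mul h4 h1 hI zero_le_one
      have h6 : 1 + s ^ 2 ≤ 2 := by nlinarith
      nlinarith [mul_nonneg (pow_nonneg hs'.le p) hI]
    · have h4 : s ^ (p + 2) ≤ s ^ Module.finrank ℝ E := pow_le_pow_right₀ h hp
      have h5 : s ^ (p + 2) * I ≤ C := by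
        refine (mul_le_mul h4 h2 hI (by positivity)).trans ?_
        rw [mul_left_comm, mul_inv_cancel₀ (by positivity), mul_one]
      have h6 : s ^ p * I * (1 + s ^ 2) ≤ 2 * (s ^ (p + 2) * I) := by
        rw [pow_add]
        have : 1 ≤ s ^ 2 := by nlinarith
        nlinarith [mul_nonneg (pow_nonneg hs'.le p) hI]
      linarith

theorem integral_rayIntegral_mul {p : ℕ} (hp : p + 2 ≤ Module.finrank ℝ E) (a u : 𝓢(E, ℝ)) :
    ∫ x, rayIntegral p a x * u x = ∫ s in Ioi (0 : ℝ), s ^ p * ∫ x, a (s • x) * u x := by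
  have h := integral_integral_swap (f := fun (s : ℝ) (x : E) => s ^ p * (a (s • x) * u x))
    (integrable_prod_ray hp a u)
  simp_rw [integral_const_mul] at h
  rw [h]
  refine integral_congr_ae (Eventually.of_forall fun x => ?_)
  simp only [rayIntegral, smul_eq_mul, ← mul_assoc, integral_mul_const]

theorem integral_smul_comm (a u : E → ℝ) {s : ℝ} (hs : 0 < s) :
    ∫ y, a y * u (s • y) = (s ^ Module.finrank ℝ E)⁻¹ * ∫ y, a (s⁻¹ • y) * u y := by
  have := Measure.integral_comp_smul_of_nonneg (volume : Measure E)
    (fun y => a (s⁻¹ • y) * u y) s (hR := hs.le)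
  simp only [smul_smul, inv_mul_cancel₀ hs.ne', one_smul, smul_eq_mul] at this
  exact this

/-- Substitute `s ↦ 1 / s` and move the transform to `u`. The Jacobian gives `s ^ (-2)`, the weight
`s ^ (-p)`, and rescaling the space variable `s ^ dim`; together they make `s ^ q`. -/
theorem integral_rayIntegral_cosTransform {p q : ℕ} (hpq : p + q + 2 = Module.finrank ℝ E)
    (h u : 𝓢(E, ℝ)) :
    ∫ x, rayIntegral p (cosTransform E h) x * u x =
      ∫ x, rayIntegral q h x * cosTransform E u x := by
  rw [integral_rayIntegral_mul (by omega), integral_rayIntegral_mul (by omega)]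
  rw [← integral_comp_rpow_Ioi _ (neg_ne_zero.mpr one_ne_zero : (-1 : ℝ) ≠ 0)]
  refine setIntegral_congr_fun measurableSet_Ioi fun s hs => ?_
  have hs' : (0 : ℝ) < s := hs
  have h1 : s ^ ((-1 : ℝ) - 1) = (s ^ 2)⁻¹ := by
    rw [show (-1 : ℝ) - 1 = -((2 : ℕ) : ℝ) by norm_num, Real.rpow_neg hs'.le, Real.rpow_natCast]
  simp only [abs_neg, abs_one, one_mul, h1, Real.rpow_neg_one, smul_eq_mul]
  rw [integral_cosTransform_smul_mul, integral_smul_comm _ _ (inv_pos.mpr hs'), inv_inv,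
    ← hpq, ← mul_assoc, ← mul_assoc]
  congr 1
  rw [inv_pow, inv_pow, inv_inv]
  field_simp
  ring

/-- By duality the integral against every test function on the punctured space vanishes; continuity
upgrades almost everywhere to everywhere. -/
theorem rayIntegral_cosTransform_eq_zero {p q : ℕ} (hpq : p + q + 2 = Module.finrank ℝ E)
    (h : 𝓢(E, ℝ)) (hh : ∀ x ≠ 0, rayIntegral q h x = 0) {x : E} (hx : x ≠ 0) :
    rayIntegral p (cosTransform E h) x = 0 := by
  have hcont : ContinuousOn (rayIntegral p (cosTransform E h)) {0}ᶜ :=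
    (rayIntegral_contDiffOn p (cosTransform E h)).continuousOn
  have : Nontrivial E := Module.nontrivial_of_finrank_pos (R := ℝ) (by omega)
  have hae0 : ∀ᵐ y : E, y ≠ 0 := by
    rw [ae_iff]; simp
  have h1 : ∀ᵐ y : E, y ∈ ({0}ᶜ : Set E) → rayIntegral p (cosTransform E h) y = 0 := by
    refine isOpen_compl_singleton.ae_eq_zero_of_integral_contDiff_smul_eq_zero
      (hcont.locallyIntegrableOn isOpen_compl_singleton.measurableSet) fun g hg hgc _ => ?_
    have h2 := integral_rayIntegral_cosTransform hpq h (hgc.toSchwartzMap hg)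
    have h3 : ∫ y, rayIntegral q h y * cosTransform E (hgc.toSchwartzMap hg) y = 0 := by
      refine integral_eq_zero_of_ae ?_
      filter_upwards [hae0] with y hy
      simp [hh y hy]
    rw [h3] at h2
    rw [← h2]
    exact integral_congr_ae (Eventually.of_forall fun y => mul_comm _ _)
  exact Measure.eqOn_open_of_ae_eq (μ := (volume : Measure E)) (g := fun _ => (0 : ℝ))
    ((ae_restrict_iff' isOpen_compl_singleton.measurableSet).mpr h1)
    isOpen_compl_singleton hcont continuousOn_const hx

end Cosine

/-! ### Uniformly distributed measures -/

section UniformlyDistributed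

variable {X : Type} [MetricSpace X] [CompactSpace X] [MeasurableSpace X] [BorelSpace X]

theorem ball_pos_of_uniform {ν : Measure X} [IsFiniteMeasure ν] (hν0 : ν ≠ 0)
    (hν : ∀ x y r, ν.real (Metric.ball x r) = ν.real (Metric.ball y r)) (x : X) {r : ℝ}
    (hr : 0 < r) : 0 < ν.real (Metric.ball x r) := by
  refine measureReal_nonneg.lt_of_ne fun h => hν0 ?_
  rw [← Measure.measure_univ_eq_zero]
  refine isCompact_univ.measure_zero_of_nhdsWithin fun y _ =>
    ⟨Metric.ball y r, mem_nhdsWithin_of_mem_nhds (Metric.ball_mem_nhds y hr), ?_⟩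
  rw [← measureReal_eq_zero_iff, ← hν x y r, ← h]

/-- Two finite measures on a compact metric space, for each of which all balls of a given radius
have the same measure, are proportional. -/
theorem integral_eq_of_uniform {μ ν : Measure X} [IsFiniteMeasure μ] [IsFiniteMeasure ν]
    (hμ : ∀ x y r, μ.real (Metric.ball x r) = μ.real (Metric.ball y r))
    (hν : ∀ x y r, ν.real (Metric.ball x r) = ν.real (Metric.ball y r))
    {f : X → ℝ} (hf : Continuous f) :
    ν.real univ * ∫ x, f x ∂μ = μ.real univ * ∫ x, f x ∂ν := by
  rcases eq_or_ne ν 0 with rfl | hν0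
  · simp
  rcases isEmpty_or_nonempty X with hX | ⟨⟨o⟩⟩
  · simp [Measure.eq_zero_of_isEmpty]
  obtain ⟨M, hM⟩ : ∃ M, ∀ x, ‖f x‖ ≤ M := by
    obtain ⟨M, hM⟩ := isCompact_univ.exists_bound_of_continuousOn hf.continuousOn
    exact ⟨M, fun x => hM x (mem_univ x)⟩
  have hfν : Integrable f ν := Integrable.of_bound hf.aestronglyMeasurable M (.of_forall hM)
  have hfμ : Integrable f μ := Integrable.of_bound hf.aestronglyMeasurable M (.of_forall hM)
  have huc : UniformContinuous f := CompactSpace.uniformContinuous_of_continuous hf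
  refine eq_of_abs_sub_le_all fun ε hε => ?_
  -- The summand `1` keeps `w` positive even when `μ` vanishes.
  set w : ℝ := μ.real univ * ν.real univ + 1
  have hw : 0 < w := by positivity
  obtain ⟨r, hr, hfr⟩ := Metric.uniformContinuous_iff.mp huc (ε / w) (by positivity)
  set g := μ.real (Metric.ball o r)
  set h := ν.real (Metric.ball o r)
  have hh : 0 < h := ball_pos_of_uniform hν0 hν o hr
  have hopen : MeasurableSet {z : X × X | dist z.1 z.2 < r} :=
    (isOpen_lt continuous_dist continuous_const).measurableSet
  -- Fubini on the symmetric set `dist x y < r`: each `y` lies in the balls centred in a set of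
  -- constant `μ`-measure `g`.
  have swap : ∀ k : X → ℝ, Continuous k →
      ∫ x, ∫ y in Metric.ball x r, k y ∂ν ∂μ = g * ∫ y, k y ∂ν := by
    intro k hk
    obtain ⟨K, hK⟩ := isCompact_univ.exists_bound_of_continuousOn hk.continuousOn
    have hint : Integrable (fun z : X × X => {z : X × X | dist z.1 z.2 < r}.indicator
        (fun z => k z.2) z) (μ.prod ν) := by
      refine Integrable.indicator ?_ hopen
      exact Integrable.of_bound (hk.comp continuous_snd).aestronglyMeasurable K
        (.of_forall fun z => hK z.2 (mem_univ _))
    have h1 := integral_integral_swap (f := fun x y => {z : X × X | dist z.1 z.2 < r}.indicator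
        (fun z => k z.2) (x, y)) hint
    have h2 : ∀ x, ∫ y, {z : X × X | dist z.1 z.2 < r}.indicator (fun z => k z.2) (x, y) ∂ν =
        ∫ y in Metric.ball x r, k y ∂ν := by
      intro x
      rw [← integral_indicator Metric.isOpen_ball.measurableSet]
      refine integral_congr_ae (.of_forall fun y => ?_)
      simp only [indicator, Metric.mem_ball, mem_ofPred_eq, dist_comm y x]
    have h3 : ∀ y, ∫ x, {z : X × X | dist z.1 z.2 < r}.indicator (fun z => k z.2) (x, y) ∂μ =
        g * k y := by
      intro y
      have : ∀ x, {z : X × X | dist z.1 z.2 < r}.indicator (fun z => k z.2) (x, y) =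
          (Metric.ball y r).indicator (fun _ => k y) x := by
        intro x
        simp only [indicator, Metric.mem_ball, mem_ofPred_eq]
      simp only [this]
      rw [integral_indicator Metric.isOpen_ball.measurableSet, setIntegral_const, smul_eq_mul,
        hμ y o r]
    simp only [h2, h3] at h1
    rw [h1, integral_const_mul]
  have e1 : h * μ.real univ = g * ν.real univ := by
    have := swap (fun _ => 1) continuous_const
    have h5 : ∀ x, ∫ _ in Metric.ball x r, (1 : ℝ) ∂ν = h := fun x => by
      rw [setIntegral_const, smul_eq_mul, mul_one, hν x o r]
    simp only [h5, integral_const, smul_eq_mul, mul_one] at this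
    linarith
  -- At scale `r` the function `f` oscillates by less than `ε / w`, so `h * f x` is close to the
  -- `ν`-integral of `f` over the ball about `x`.
  have e2 : |h * ∫ x, f x ∂μ - g * ∫ x, f x ∂ν| ≤ h * (ε / w) * μ.real univ := by
    have hmeas : Integrable (fun x => ∫ y in Metric.ball x r, f y ∂ν) μ := by
      have hint : Integrable (fun z : X × X => {z : X × X | dist z.1 z.2 < r}.indicator
          (fun z => f z.2) z) (μ.prod ν) := by
        refine Integrable.indicator ?_ hopen
        exact Integrable.of_bound (hf.comp continuous_snd).aestronglyMeasurable M
          (.of_forall fun z => hM z.2)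
      refine hint.integral_prod_left.congr (.of_forall fun x => ?_)
      simp only
      rw [← integral_indicator Metric.isOpen_ball.measurableSet]
      refine integral_congr_ae (.of_forall fun y => ?_)
      simp only [indicator, Metric.mem_ball, mem_ofPred_eq, dist_comm y x]
    rw [← swap f hf, ← integral_const_mul, ← integral_sub (hfμ.const_mul h) hmeas,
      ← Real.norm_eq_abs]
    refine norm_integral_le_of_norm_le_const (.of_forall fun x => ?_)
    have h4 : h * f x = ∫ y in Metric.ball x r, f x ∂ν := by
      rw [setIntegral_const, smul_eq_mul, hν x o r]
    rw [h4, ← integral_sub (integrable_const _) hfν.integrableOn, mul_comm h,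
      show h = ν.real (Metric.ball x r) from hν o x r]
    refine norm_setIntegral_le_of_norm_le_const (measure_lt_top _ _) fun y hy => ?_
    rw [← dist_eq_norm]
    exact (hfr (by rw [dist_comm]; exact hy)).le
  have e3 : h * (ν.real univ * ∫ x, f x ∂μ - μ.real univ * ∫ x, f x ∂ν) =
      ν.real univ * (h * ∫ x, f x ∂μ - g * ∫ x, f x ∂ν) := by
    linear_combination (-∫ x, f x ∂ν) * e1
  have hν1 : 0 ≤ ν.real univ := measureReal_nonneg
  have hμ1 : 0 ≤ μ.real univ := measureReal_nonneg
  have e4 : h * |ν.real univ * ∫ x, f x ∂μ - μ.real univ * ∫ x, f x ∂ν| ≤ h * ε := by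
    rw [← abs_of_pos hh, ← abs_mul, abs_of_pos hh, e3, abs_mul, abs_of_nonneg hν1]
    refine (mul_le_mul_of_nonneg_left e2 hν1).trans ?_
    have : ν.real univ * (h * (ε / w) * μ.real univ) = h * (ε * ((w - 1) / w)) := by
      simp only [w]; field_simp; ring
    rw [this]
    refine mul_le_mul_of_nonneg_left (mul_le_of_le_one_right hε.le ?_) hh.le
    rw [div_le_one hw]; linarith
  exact le_of_mul_le_mul_left e4 hh

end UniformlyDistributed

/-! ### The Hausdorff measure of the unit sphere -/

theorem euclideanHausdorffMeasure_image_le {X Y : Type} [MetricSpace X] [MeasurableSpace X]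
    [BorelSpace X] [MetricSpace Y] [MeasurableSpace Y] [BorelSpace Y] {K : NNReal} {f : X → Y}
    {s : Set X} (h : LipschitzOnWith K f s) (d : ℕ) :
    μHE[d] (f '' s) ≤ (K : ENNReal) ^ d * μHE[d] s := by
  rw [Measure.euclideanHausdorffMeasure_def, Measure.euclideanHausdorffMeasure_def,
    Measure.smul_apply, Measure.smul_apply, mul_smul_comm]
  have := h.hausdorffMeasure_image_le (d := d) (Nat.cast_nonneg d)
  rw [ENNReal.rpow_natCast] at this
  exact smul_le_smul_of_nonneg_left this (by positivity)

theorem norm_sq_eq_inner_sq_add {F : Type} [NormedAddCommGroup F] [InnerProductSpace ℝ F]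
    {v : F} (hv : ‖v‖ = 1) (x : F) :
    ‖x‖ ^ 2 = inner ℝ v x ^ 2 + ‖(ℝ ∙ v)ᗮ.orthogonalProjectionOnto x‖ ^ 2 := by
  rw [Submodule.norm_sq_eq_add_norm_sq_projection x (ℝ ∙ v)]
  congr 1
  change ‖(ℝ ∙ v).starProjection x‖ ^ 2 = _
  rw [Submodule.starProjection_unit_singleton ℝ hv, norm_smul, hv, mul_one, Real.norm_eq_abs,
    sq_abs]

section Sphere

variable {d : ℕ} {F : Type} [NormedAddCommGroup F] [InnerProductSpace ℝ F]
  [FiniteDimensional ℝ F] [MeasurableSpace F] [BorelSpace F]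

theorem isAddHaarMeasure_orthogonal (hF : Module.finrank ℝ F = d + 1) {v : F} (hv : ‖v‖ = 1) :
    (μHE[d] : Measure (ℝ ∙ v)ᗮ).IsAddHaarMeasure := by
  have : Fact (Module.finrank ℝ F = d + 1) := ⟨hF⟩
  have h : Module.finrank ℝ (ℝ ∙ v)ᗮ = d :=
    Submodule.finrank_orthogonal_span_singleton (by rw [← norm_ne_zero_iff, hv]; exact one_ne_zero)
  have h2 : (μHE[Module.finrank ℝ (ℝ ∙ v)ᗮ] : Measure (ℝ ∙ v)ᗮ).IsAddHaarMeasure := inferInstance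
  rwa [h] at h2

/-- By compactness it suffices to bound caps. On the cap `⟪v, x⟫ > 1/2` the projection to `v^⊥` has
a Lipschitz inverse, and its image lies in the unit ball, of finite Haar measure. -/
theorem hausdorff_sphere_lt_top (hF : Module.finrank ℝ F = d + 1) :
    μHE[d] (Metric.sphere (0 : F) 1) < ⊤ := by
  refine (isCompact_sphere _ _).measure_lt_top_of_nhdsWithin fun v hv => ?_
  have hv1 : ‖v‖ = 1 := by simpa using hv
  have := isAddHaarMeasure_orthogonal hF hv1
  set P : Set F := {x | ‖x‖ = 1 ∧ 1 / 2 < (inner ℝ v x : ℝ)}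
  set p : F → (ℝ ∙ v)ᗮ := fun x => (ℝ ∙ v)ᗮ.orthogonalProjectionOnto x
  have hP : P ∈ 𝓝[Metric.sphere (0 : F) 1] v := by
    refine mem_nhdsWithin.mpr ⟨{x | 1 / 2 < (inner ℝ v x : ℝ)},
      isOpen_lt continuous_const (by fun_prop), ?_, fun x hx => ⟨by simpa using hx.2, hx.1⟩⟩
    simp [hv1]
    norm_num
  refine ⟨P, hP, ?_⟩
  -- With `D` the distance of the projections, the components along `v` differ by at most `2 D`,
  -- since they sum to at least `1` and the norms of the projections to at most `2`. Hence `‖x - y‖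
  -- ^ 2 ≤ 5 D ^ 2 ≤ (3 D) ^ 2`.
  have hanti : ∀ x ∈ P, ∀ y ∈ P, dist x y ≤ 3 * dist (p x) (p y) := by
    intro x hx y hy
    have h1 := norm_sq_eq_inner_sq_add hv1 x
    have h2 := norm_sq_eq_inner_sq_add hv1 y
    have h3 := norm_sq_eq_inner_sq_add hv1 (x - y)
    rw [hx.1] at h1
    rw [hy.1] at h2
    rw [inner_sub_right, map_sub] at h3
    have hx2 := hx.2
    have hy2 := hy.2
    rw [dist_eq_norm, dist_eq_norm]
    change ‖x - y‖ ≤ 3 * ‖(ℝ ∙ v)ᗮ.orthogonalProjectionOnto x - (ℝ ∙ v)ᗮ.orthogonalProjectionOnto y‖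
    have h4 := abs_norm_sub_norm_le ((ℝ ∙ v)ᗮ.orthogonalProjectionOnto x)
      ((ℝ ∙ v)ᗮ.orthogonalProjectionOnto y)
    set a : ℝ := inner ℝ v x
    set b : ℝ := inner ℝ v y
    set s := ‖(ℝ ∙ v)ᗮ.orthogonalProjectionOnto x‖
    set t := ‖(ℝ ∙ v)ᗮ.orthogonalProjectionOnto y‖
    set D := ‖(ℝ ∙ v)ᗮ.orthogonalProjectionOnto x - (ℝ ∙ v)ᗮ.orthogonalProjectionOnto y‖
    have hs : 0 ≤ s := norm_nonneg _
    have ht : 0 ≤ t := norm_nonneg _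
    have hD : 0 ≤ D := norm_nonneg _
    have hs1 : s ≤ 1 := by nlinarith
    have ht1 : t ≤ 1 := by nlinarith
    have h5 : |a - b| * (a + b) = |s - t| * (s + t) := by
      have h51 := abs_mul (a - b) (a + b)
      have h52 := abs_mul (s - t) (s + t)
      rw [abs_of_pos (show 0 < a + b by linarith)] at h51
      rw [abs_of_nonneg (show 0 ≤ s + t by linarith)] at h52
      rw [← h51, ← h52, ← abs_neg]
      congr 1
      linarith
    have h6 : |a - b| ≤ 2 * D := by
      have : |a - b| * 1 ≤ |a - b| * (a + b) :=
        mul_le_mul_of_nonneg_left (by linarith) (abs_nonneg _)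
      have h7 : |s - t| * (s + t) ≤ D * 2 := mul_le_mul h4 (by linarith) (by linarith) hD
      linarith
    have h8 : (a - b) ^ 2 ≤ (2 * D) ^ 2 := sq_le_sq' (by linarith [neg_abs_le (a - b)])
      ((le_abs_self _).trans h6)
    nlinarith [norm_nonneg (x - y)]
  have hinj : InjOn p P := fun x hx y hy hxy => by
    have := hanti x hx y hy
    rw [hxy, dist_self, mul_zero] at this
    exact dist_le_zero.mp this
  set q := Function.invFunOn p P
  have hq : ∀ x ∈ P, q (p x) = x := fun x hx => hinj.leftInvOn_invFunOn hx
  have hlip : LipschitzOnWith 3 q (p '' P) := by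
    refine LipschitzOnWith.of_dist_le_mul ?_
    rintro _ ⟨x, hx, rfl⟩ _ ⟨y, hy, rfl⟩
    rw [hq x hx, hq y hy]
    exact hanti x hx y hy
  have himg : q '' (p '' P) = P := by
    rw [image_image]
    exact (image_congr fun x hx => hq x hx).trans (image_id' P)
  rw [← himg]
  refine (euclideanHausdorffMeasure_image_le hlip d).trans_lt ?_
  refine ENNReal.mul_lt_top (by simp) ?_
  refine (measure_mono ?_).trans_lt ((isCompact_closedBall (0 : (ℝ ∙ v)ᗮ) 1).measure_lt_top)
  rintro _ ⟨x, hx, rfl⟩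
  have h1 := norm_sq_eq_inner_sq_add hv1 x
  rw [hx.1] at h1
  rw [mem_closedBall_zero_iff]
  change ‖(ℝ ∙ v)ᗮ.orthogonalProjectionOnto x‖ ≤ 1
  nlinarith [sq_nonneg (inner ℝ v x : ℝ)]

/-- The projection to `v^⊥` is 1-Lipschitz and maps the sphere onto a set containing the unit ball:
lift `y` to height `√(1 - ‖y‖ ^ 2)`. -/
theorem hausdorff_sphere_pos (hF : Module.finrank ℝ F = d + 1) :
    0 < μHE[d] (Metric.sphere (0 : F) 1) := by
  have : Nontrivial F := Module.nontrivial_of_finrank_pos (R := ℝ) (by omega)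
  obtain ⟨v, hv1⟩ := exists_norm_eq F zero_le_one
  have := isAddHaarMeasure_orthogonal hF hv1
  set p : F → (ℝ ∙ v)ᗮ := fun x => (ℝ ∙ v)ᗮ.orthogonalProjectionOnto x
  have hp : LipschitzOnWith 1 p (Metric.sphere (0 : F) 1) :=
    ((ℝ ∙ v)ᗮ.lipschitzWith_orthogonalProjectionOnto).lipschitzOnWith
  have h1 := euclideanHausdorffMeasure_image_le hp d
  simp only [ENNReal.coe_one, one_pow, one_mul] at h1
  refine lt_of_lt_of_le ?_ h1
  refine (Metric.measure_ball_pos μHE[d] (0 : (ℝ ∙ v)ᗮ) one_pos).trans_le (measure_mono ?_)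
  intro y hy
  rw [mem_ball_zero_iff] at hy
  have hy2 : 0 ≤ 1 - ‖y‖ ^ 2 := by nlinarith [norm_nonneg y]
  have hpx : p ((y : F) + √(1 - ‖y‖ ^ 2) • v) = y := by
    simp [p]
  refine ⟨(y : F) + √(1 - ‖y‖ ^ 2) • v, ?_, hpx⟩
  have h2 := norm_sq_eq_inner_sq_add hv1 ((y : F) + √(1 - ‖y‖ ^ 2) • v)
  rw [show (ℝ ∙ v)ᗮ.orthogonalProjectionOnto ((y : F) + √(1 - ‖y‖ ^ 2) • v) = y from hpx,
    inner_add_right, Submodule.mem_orthogonal_singleton_iff_inner_right.mp y.2, inner_smul_right,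
    real_inner_self_eq_norm_sq, hv1, zero_add, one_pow, mul_one, Real.sq_sqrt hy2,
    sub_add_cancel] at h2
  rw [mem_sphere_zero_iff_norm]
  exact (pow_eq_one_iff_of_nonneg (norm_nonneg _) two_ne_zero).mp h2

end Sphere

/-! ### Averages over the unit sphere -/

/-- The reflection in the hyperplane orthogonal to `x - y` swaps the two centres. Measures invariant
under isometries are therefore uniformly distributed on the sphere. -/
theorem image_sphere_ball {F : Type} [NormedAddCommGroup F] [InnerProductSpace ℝ F]
    (x y : Metric.sphere (0 : F) 1) (r : ℝ) :
    ∃ e : F ≃ₗᵢ[ℝ] F, e '' (Subtype.val '' Metric.ball x r) = Subtype.val '' Metric.ball y r := by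
  have hxy : ‖(x : F)‖ = ‖(y : F)‖ := by
    rw [mem_sphere_zero_iff_norm.mp x.2, mem_sphere_zero_iff_norm.mp y.2]
  have hy : (ℝ ∙ ((x : F) - y))ᗮ.reflection x = y := Submodule.reflection_sub hxy
  set e := (ℝ ∙ ((x : F) - y))ᗮ.reflection
  have he : ∀ z, e (e z) = z := fun z => Submodule.reflection_reflection _ z
  have hx : e y = x := by
    have := congrArg e hy
    rw [he] at this
    exact this.symm
  have key : ∀ a b : Metric.sphere (0 : F) 1, e a = b →
      e '' (Subtype.val '' Metric.ball a r) ⊆ Subtype.val '' Metric.ball b r := by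
    rintro a b hab _ ⟨_, ⟨z, hz, rfl⟩, rfl⟩
    refine ⟨⟨e z, ?_⟩, ?_, rfl⟩
    · rw [mem_sphere_zero_iff_norm, e.norm_map, mem_sphere_zero_iff_norm.mp z.2]
    · rw [Metric.mem_ball, Subtype.dist_eq, ← hab]
      change dist (e z) (e a) < r
      rw [e.dist_map]
      exact hz
  refine ⟨e, (key x y hy).antisymm fun z hz => ?_⟩
  refine ⟨e z, key y x hx ⟨z, hz, rfl⟩, he z⟩

theorem hausdorff_sphere_uniform {d : ℕ} {F : Type} [NormedAddCommGroup F] [InnerProductSpace ℝ F]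
    [MeasurableSpace F] [BorelSpace F] (x y : Metric.sphere (0 : F) 1) (r : ℝ) :
    (μHE[d] : Measure (Metric.sphere (0 : F) 1)).real (Metric.ball x r) =
      (μHE[d] : Measure (Metric.sphere (0 : F) 1)).real (Metric.ball y r) := by
  obtain ⟨e, he⟩ := image_sphere_ball x y r
  have hi : Isometry (Subtype.val : Metric.sphere (0 : F) 1 → F) := isometry_subtype_coe
  rw [Measure.real, Measure.real, ← hi.euclideanHausdorffMeasure_image,
    ← hi.euclideanHausdorffMeasure_image, ← he, e.isometry.euclideanHausdorffMeasure_image]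

section Average

variable {d : ℕ} {F : Type} [NormedAddCommGroup F] [InnerProductSpace ℝ F]
  [FiniteDimensional ℝ F] [MeasurableSpace F] [BorelSpace F]

instance isFiniteMeasure_hausdorff_sphere [Fact (Module.finrank ℝ F = d + 1)] :
    IsFiniteMeasure (μHE[d] : Measure (Metric.sphere (0 : F) 1)) := by
  refine ⟨?_⟩
  rw [← isometry_subtype_coe.euclideanHausdorffMeasure_image, image_univ, Subtype.range_coe]
  exact hausdorff_sphere_lt_top (Fact.out : Module.finrank ℝ F = d + 1)

theorem hausdorff_sphere_univ_pos [Fact (Module.finrank ℝ F = d + 1)] :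
    0 < (μHE[d] : Measure (Metric.sphere (0 : F) 1)).real univ := by
  refine ENNReal.toReal_pos ?_ (measure_ne_top _ _)
  rw [← isometry_subtype_coe.euclideanHausdorffMeasure_image, image_univ, Subtype.range_coe]
  exact (hausdorff_sphere_pos (Fact.out : Module.finrank ℝ F = d + 1)).ne'

theorem toSphere_uniform (x y : Metric.sphere (0 : F) 1) (r : ℝ) :
    (volume : Measure F).toSphere.real (Metric.ball x r) =
      (volume : Measure F).toSphere.real (Metric.ball y r) := by
  obtain ⟨e, he⟩ := image_sphere_ball x y r
  rw [Measure.real, Measure.real, Measure.toSphere_apply' _ Metric.isOpen_ball.measurableSet,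
    Measure.toSphere_apply' _ Metric.isOpen_ball.measurableSet, ← he]
  have h : Ioo (0 : ℝ) 1 • (e '' (Subtype.val '' Metric.ball x r)) =
      e '' (Ioo (0 : ℝ) 1 • (Subtype.val '' Metric.ball x r)) := by
    rw [← image2_smul, ← image2_smul, image2_image_right, image_image2]
    exact image2_congr fun a _ b _ => (e.map_smul a b).symm
  rw [h, e.image_eq_preimage_symm]
  congr 2
  exact (e.symm.measurePreserving.measure_preimage_emb
    e.symm.toHomeomorph.measurableEmbedding _).symm

theorem average_hausdorff_eq_average_toSphere [Fact (Module.finrank ℝ F = d + 1)]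
    {f : Metric.sphere (0 : F) 1 → ℝ} (hf : Continuous f) :
    ((μHE[d] : Measure (Metric.sphere (0 : F) 1)).real univ)⁻¹ * ∫ x, f x ∂μHE[d] =
      ((volume : Measure F).toSphere.real univ)⁻¹ * ∫ x, f x ∂(volume : Measure F).toSphere := by
  have : Nontrivial F := Module.nontrivial_of_finrank_pos (R := ℝ)
    (by rw [(Fact.out : Module.finrank ℝ F = d + 1)]; omega)
  have h := integral_eq_of_uniform (μ := (μHE[d] : Measure (Metric.sphere (0 : F) 1)))
    (ν := (volume : Measure F).toSphere) hausdorff_sphere_uniform toSphere_uniform hf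
  have h1 := hausdorff_sphere_univ_pos (d := d) (F := F)
  have h2 : (volume : Measure F).toSphere.real univ ≠ 0 := by
    rw [Ne, measureReal_eq_zero_iff, Measure.measure_univ_eq_zero]
    exact Measure.toSphere_ne_zero _
  rw [inv_mul_eq_div, inv_mul_eq_div, div_eq_div_iff h1.ne' h2]
  linarith

/-- Polar coordinates; the origin is a null set. -/
theorem integral_radial_mul (w : ℝ → ℝ) (f : F → ℝ) [Nontrivial F] :
    ∫ y : F, w ‖y‖ * f (‖y‖⁻¹ • y) =
      (∫ r : Ioi (0 : ℝ), w r ∂(Measure.volumeIoiPow (Module.finrank ℝ F - 1))) *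
        ∫ x : Metric.sphere (0 : F) 1, f x ∂(volume : Measure F).toSphere := by
  have h1 : ∫ y : F, w ‖y‖ * f (‖y‖⁻¹ • y) =
      ∫ y : ({(0)}ᶜ : Set F), w ‖y.1‖ * f (‖y.1‖⁻¹ • y.1) ∂((volume : Measure F).comap (↑)) := by
    rw [integral_subtype_comap (measurableSet_singleton _).compl
      fun y : F => w ‖y‖ * f (‖y‖⁻¹ • y), restrict_compl_singleton]
  have h2 := (volume : Measure F).measurePreserving_homeomorphUnitSphereProd.integral_comp
    (Homeomorph.measurableEmbedding _) fun z => f z.1 * w z.2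
  rw [h1, mul_comm]
  have h3 := integral_prod_mul (μ := (volume : Measure F).toSphere)
    (ν := Measure.volumeIoiPow (Module.finrank ℝ F - 1)) (fun x => f x) (fun r => w r)
  rw [← h3, ← h2]
  refine integral_congr_ae (.of_forall fun y => ?_)
  simp [mul_comm]

end Average

/-! ### A radial weight -/

/-- The radial bump function, divided by `r ^ k`. -/
def radialWeight (k : ℕ) (r : ℝ) : ℝ := radialBump r * ((max r 1) ^ k)⁻¹

/-- The bump vanishes unless `r ^ 2 > 1`, so the `max` is harmless; it keeps the weight continuous
at `0`. -/
theorem radialWeight_eq (k : ℕ) {r : ℝ} (hr : 0 < r) :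
    radialWeight k r = radialBump r * (r ^ k)⁻¹ := by
  by_cases h : radialBump r = 0
  · simp [radialWeight, h]
  · have h1 := (of_radialBump_ne_zero h).1
    have h2 : 1 ≤ r := by nlinarith
    rw [radialWeight, max_eq_left h2]

theorem integral_radialWeight_norm_pos (k : ℕ) {F : Type} [NormedAddCommGroup F]
    [InnerProductSpace ℝ F] [FiniteDimensional ℝ F] [MeasurableSpace F] [BorelSpace F]
    [Nontrivial F] : 0 < ∫ y : F, radialWeight k ‖y‖ := by
  have hc : Continuous fun y : F => radialWeight k ‖y‖ :=
    (radialBump_continuous.comp continuous_norm).mul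
      ((((continuous_norm.max continuous_const).pow k)).inv₀ fun y =>
        pow_ne_zero _ (lt_of_lt_of_le one_pos (le_max_right _ _)).ne')
  have hs : HasCompactSupport fun y : F => radialWeight k ‖y‖ := by
    refine HasCompactSupport.intro (isCompact_closedBall (0 : F) 2) fun y hy => ?_
    have h1 : radialBump ‖y‖ = 0 := by
      by_contra h
      have h2 := (of_radialBump_ne_zero h).2
      rw [mem_closedBall_zero_iff, not_le] at hy
      nlinarith
    simp [radialWeight, h1]
  obtain ⟨v, hv⟩ := exists_norm_eq F (show (0 : ℝ) ≤ 3 / 2 by norm_num)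
  refine hc.integral_pos_of_hasCompactSupport_nonneg_nonzero hs (fun y => ?_) (x := v) ?_
  · exact mul_nonneg (radialBump_nonneg _) (by positivity)
  · have h1 : 0 < radialBump ‖v‖ := radialBump_pos (by rw [hv]; norm_num) (by rw [hv]; norm_num)
    have h2 : 0 < ((max ‖v‖ 1) ^ k)⁻¹ := by positivity
    exact (mul_pos h1 h2).ne'

/-! ### The Fourier slice theorem -/

/-- Orthogonal coordinates adapted to a unit vector. -/
def splitting {E : Type} [NormedAddCommGroup E] [InnerProductSpace ℝ E]
    {ζ : E} (hζ : ‖ζ‖ = 1) : ℝ × (ℝ ∙ ζ)ᗮ ≃ E :=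
  ((LinearIsometryEquiv.toSpanUnitSingleton ζ hζ).toEquiv.prodCongr (Equiv.refl _)).trans
    ((WithLp.equiv 2 _).symm.trans (ℝ ∙ ζ).orthogonalDecomposition.symm.toEquiv)

theorem splitting_apply {E : Type} [NormedAddCommGroup E] [InnerProductSpace ℝ E]
    {ζ : E} (hζ : ‖ζ‖ = 1) (z : ℝ × (ℝ ∙ ζ)ᗮ) :
    splitting hζ z = z.1 • ζ + z.2 := by
  simp [splitting]

theorem norm_le_norm_smul_add {E : Type} [NormedAddCommGroup E] [InnerProductSpace ℝ E]
    {ζ : E} (t : ℝ) (y : (ℝ ∙ ζ)ᗮ) :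
    ‖y‖ ≤ ‖t • ζ + (y : E)‖ := by
  have h : inner ℝ (t • ζ) (y : E) = 0 := by
    rw [inner_smul_left, Submodule.mem_orthogonal_singleton_iff_inner_right.mp y.2, mul_zero]
  have h1 := norm_add_sq_eq_norm_sq_add_norm_sq_of_inner_eq_zero _ _ h
  rw [Submodule.coe_norm]
  nlinarith [norm_nonneg (t • ζ), norm_nonneg (t • ζ + (y : E)), norm_nonneg (y : E)]

theorem integrable_line {E : Type} [NormedAddCommGroup E] [InnerProductSpace ℝ E]
    (h : 𝓢(E, ℂ)) {ζ : E} (hζ : ‖ζ‖ = 1) :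
    Integrable fun s : ℝ => h (s • ζ) := by
  obtain ⟨S, hS⟩ := exists_decay_zero h 2
  refine (integrable_inv_one_add_sq.const_mul S).mono'
    (h.continuous.comp (continuous_id.smul continuous_const)).aestronglyMeasurable
    (.of_forall fun s => ?_)
  have h1 := hS (s • ζ)
  rw [norm_smul, hζ, mul_one, Real.norm_eq_abs] at h1
  rw [← div_eq_mul_inv, le_div_iff₀ (by positivity)]
  have h2 : 1 + s ^ 2 ≤ (1 + |s|) ^ 2 := by
    rw [← sq_abs s]; nlinarith [abs_nonneg s]
  nlinarith [norm_nonneg (h (s • ζ))]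

theorem splitting_continuous {E : Type} [NormedAddCommGroup E] [InnerProductSpace ℝ E]
    {ζ : E} (hζ : ‖ζ‖ = 1) : Continuous (splitting hζ) := by
  have : (splitting hζ : ℝ × (ℝ ∙ ζ)ᗮ → E) = fun z => z.1 • ζ + (z.2 : E) :=
    funext (splitting_apply hζ)
  rw [this]
  fun_prop

section Slice

variable {E : Type} [NormedAddCommGroup E] [InnerProductSpace ℝ E] [FiniteDimensional ℝ E]
  [MeasurableSpace E] [BorelSpace E]

theorem splitting_measurePreserving {ζ : E} (hζ : ‖ζ‖ = 1) :
    MeasurePreserving (splitting hζ) := by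
  have h0 : MeasurePreserving (LinearIsometryEquiv.toSpanUnitSingleton ζ hζ) volume volume :=
    (LinearIsometryEquiv.toSpanUnitSingleton ζ hζ).measurePreserving
  have h1 := h0.prod (MeasurePreserving.id (volume : Measure (ℝ ∙ ζ)ᗮ))
  have h2 := WithLp.volume_preserving_toLp (ℝ ∙ ζ) (ℝ ∙ ζ)ᗮ
  exact (ℝ ∙ ζ).orthogonalDecomposition.symm.measurePreserving.comp (h2.comp h1)

theorem splitting_measurableEmbedding {ζ : E} (hζ : ‖ζ‖ = 1) :
    MeasurableEmbedding (splitting hζ) :=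
  (splitting_continuous hζ).measurableEmbedding (splitting hζ).injective

theorem integrable_comp_splitting {ζ : E} (hζ : ‖ζ‖ = 1) (h : 𝓢(E, ℂ)) :
    Integrable (fun z : ℝ × (ℝ ∙ ζ)ᗮ => h (z.1 • ζ + z.2)) (volume.prod volume) := by
  have := ((splitting_measurePreserving hζ).integrable_comp_emb
    (splitting_measurableEmbedding hζ) (g := h)).mpr h.integrable
  refine this.congr (.of_forall fun z => ?_)
  simp [splitting_apply]

/-- Fubini in the coordinates `t ζ + y`: the character at `s ζ` does not see `y`. -/
theorem fourier_slice {ζ : E} (hζ : ‖ζ‖ = 1) (h : 𝓢(E, ℂ)) (s : ℝ) :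
    𝓕 (fun t : ℝ => ∫ y : (ℝ ∙ ζ)ᗮ, h (t • ζ + y)) s = 𝓕 h (s • ζ) := by
  rw [Real.fourier_eq, fourier_coe, Real.fourier_eq,
    ← (splitting_measurePreserving hζ).integral_comp (splitting_measurableEmbedding hζ),
    Measure.volume_eq_prod, integral_prod]
  · refine integral_congr_ae (.of_forall fun t => ?_)
    simp only [Circle.smul_def]
    rw [← integral_smul]
    refine integral_congr_ae (.of_forall fun y => ?_)
    simp only [splitting_apply]
    congr 3
    rw [inner_add_left, inner_smul_left, inner_smul_right, inner_smul_right,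
      real_inner_comm ζ (y : E),
      Submodule.mem_orthogonal_singleton_iff_inner_right.mp y.2, real_inner_self_eq_norm_sq, hζ]
    simp [mul_comm]
  · have h1 : Integrable fun x : E => Real.fourierChar (-inner ℝ x (s • ζ)) • h x :=
      (Real.fourierIntegral_convergent_iff _).mpr h.integrable
    exact ((splitting_measurePreserving hζ).integrable_comp_emb
      (splitting_measurableEmbedding hζ)).mpr h1

/-- Since `‖y‖ ≤ ‖t ζ + y‖`, the decay in `y` is uniform in `t`. Pointwise Fourier inversion at `t =
0` requires this continuity. -/
theorem continuous_integral_slice (ζ : E) (h : 𝓢(E, ℂ)) :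
    Continuous fun t : ℝ => ∫ y : (ℝ ∙ ζ)ᗮ, h (t • ζ + y) := by
  set N := Module.finrank ℝ (ℝ ∙ ζ)ᗮ + 1
  obtain ⟨S, hS⟩ := exists_decay_zero h N
  have hint : Integrable fun y : (ℝ ∙ ζ)ᗮ => (1 + ‖y‖) ^ (-(N : ℝ)) :=
    integrable_one_add_norm (by simp [N])
  refine continuous_of_dominated (bound := fun y => S * (1 + ‖y‖) ^ (-(N : ℝ)))
    (fun t => (h.continuous.comp (by fun_prop)).aestronglyMeasurable)
    (fun t => .of_forall fun y => ?_) (hint.const_mul S) (.of_forall fun y => ?_)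
  · have h1 := hS (t • ζ + y)
    have h2 : (1 + ‖y‖) ^ N ≤ (1 + ‖t • ζ + (y : E)‖) ^ N :=
      pow_le_pow_left₀ (by positivity) (by linarith [norm_le_norm_smul_add t y]) N
    rw [Real.rpow_neg (by positivity), Real.rpow_natCast, ← div_eq_mul_inv,
      le_div_iff₀ (by positivity), mul_comm]
    exact (mul_le_mul_of_nonneg_right h2 (norm_nonneg _)).trans h1
  · exact h.continuous.comp (by fun_prop)

theorem integral_fourier_line {ζ : E} (hζ : ‖ζ‖ = 1) (h : 𝓢(E, ℂ)) :
    ∫ s : ℝ, 𝓕 h (s • ζ) = ∫ y : (ℝ ∙ ζ)ᗮ, h y := by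
  have h0 : 𝓕 (fun t : ℝ => ∫ y : (ℝ ∙ ζ)ᗮ, h (t • ζ + y)) = fun s => 𝓕 h (s • ζ) :=
    funext fun s => fourier_slice hζ h s
  have h1 : Integrable fun t : ℝ => ∫ y : (ℝ ∙ ζ)ᗮ, h (t • ζ + y) :=
    (integrable_comp_splitting hζ h).integral_prod_left
  have h2 := h1.fourierInv_fourier_eq (v := 0) (by rw [h0]; exact integrable_line (𝓕 h) hζ)
    (continuous_integral_slice ζ h).continuousAt
  rw [h0, Real.fourierInv_eq] at h2
  simpa using h2

/-- Evenness makes the half-line integral half of the line integral in `integral_fourier_line`. -/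
theorem rayIntegral_cosTransform_zero {ζ : E} (hζ : ‖ζ‖ = 1) {h : 𝓢(E, ℝ)}
    (hh : ∀ x, h (-x) = h x) :
    rayIntegral 0 (cosTransform E h) ζ = 2⁻¹ * ∫ y : (ℝ ∙ ζ)ᗮ, h y := by
  have h1 := integral_fourier_line hζ (postcompCLM Complex.ofRealCLM h)
  have h2 : ∀ s : ℝ, 𝓕 (postcompCLM Complex.ofRealCLM h : 𝓢(E, ℂ)) (s • ζ) =
      (cosTransform E h (|s| • ζ) : ℂ) := by
    intro s
    have h3 : cosTransform E h (|s| • ζ) = cosTransform E h (s • ζ) := by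
      rcases abs_choice s with hs | hs <;> rw [hs]
      rw [neg_smul, cosTransform_even hh]
    rw [h3, ofReal_cosTransform hh]
    rfl
  have h4 : ∀ y : (ℝ ∙ ζ)ᗮ, (postcompCLM Complex.ofRealCLM h : 𝓢(E, ℂ)) y = (h y : ℂ) :=
    fun y => rfl
  simp only [h2, h4] at h1
  rw [integral_complex_ofReal, integral_complex_ofReal,
    integral_comp_abs (f := fun s => cosTransform E h (s • ζ))]
    at h1
  have h5 := Complex.ofReal_injective h1
  rw [← h5, rayIntegral]
  simp

end Slice

/-! ### The operators `f ↦ ∫ s ^ p * cosTransform (cutoff * f) (s • x) ds` -/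

/-- Multiply by the cutoff, take the cosine transform, and integrate along rays with weight
`s ^ p`. -/
def kernelOp (m p : ℕ) : SmoothPunctured m →L[ℝ] SmoothPunctured m :=
  (rayCLM m p).comp ((cosTransform (Space m)).comp (cutoffCLM m))

theorem kernelOp_apply {m : ℕ} (p : ℕ) (f : SmoothPunctured m) (x : Space m) :
    kernelOp m p f x = rayIntegral p (cosTransform (Space m) (cutoffCLM m f)) x := rfl

theorem cutoffCLM_even {m : ℕ} {f : SmoothPunctured m} (hf : ∀ x, f (-x) = f x) (x : Space m) :
    cutoffCLM m f (-x) = cutoffCLM m f x := by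
  rw [cutoffCLM_apply, cutoffCLM_apply, hf, cutoff, cutoff, norm_neg]

theorem kernelOp_mem {m p : ℕ} {q r : ℝ} (hr : r = -((p : ℝ) + 1)) {f : SmoothPunctured m}
    (hf : f ∈ evenHomogeneous m q) : kernelOp m p f ∈ evenHomogeneous m r := by
  refine ⟨fun x => ?_, fun t ht x _ => ?_⟩
  · exact rayIntegral_neg_of_even p (cosTransform_even (cutoffCLM_even hf.1)) x
  · rw [hr]
    exact rayIntegral_smul p _ ht x

/-- The normalising constant `∫ s in (0, ∞), radialBump s / s`. -/
def bumpConstant : ℝ := ∫ s in Ioi (0 : ℝ), radialWeight 1 s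

theorem bumpConstant_pos : 0 < bumpConstant := by
  have h1 := integral_radialWeight_norm_pos 1 (F := ℝ)
  simp only [Real.norm_eq_abs] at h1
  rw [integral_comp_abs (f := radialWeight 1)] at h1
  unfold bumpConstant
  linarith

/-- Homogeneity turns the weight `s ^ p` into `1 / s`, and `ds / s` is invariant under dilations, so
the constant does not depend on `‖x‖`. -/
theorem rayIntegral_cutoff {m p : ℕ} {q : ℝ} (hq : q = -((p : ℝ) + 1)) {f : SmoothPunctured m}
    (hf : f ∈ evenHomogeneous m q) {x : Space m} (hx : x ≠ 0) :
    rayIntegral p (cutoffCLM m f) x = bumpConstant * f x := by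
  have hx' : 0 < ‖x‖ := norm_pos_iff.mpr hx
  have h1 := integral_comp_mul_right_Ioi (fun s => radialWeight 1 s) 0 hx'
  rw [zero_mul] at h1
  have h2 : ∀ s ∈ Ioi (0 : ℝ), s ^ p • cutoffCLM m f (s • x) =
      (radialWeight 1 (s * ‖x‖) * ‖x‖) * f x := by
    intro s hs
    have hs' : (0 : ℝ) < s := hs
    rw [cutoffCLM_apply, hf.2 s hs' x hx, cutoff, norm_smul, Real.norm_of_nonneg hs'.le,
      smul_eq_mul, radialWeight_eq 1 (mul_pos hs' hx'), hq, Real.rpow_neg hs'.le, Real.rpow_add_one hs'.ne',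
      Real.rpow_natCast]
    field_simp
  rw [rayIntegral, setIntegral_congr_fun measurableSet_Ioi h2, integral_mul_const,
    integral_mul_const, h1, smul_eq_mul, bumpConstant]
  field_simp

theorem kernelOp_kernelOp {m p q : ℕ} (hpq : p + q + 1 = m) {r : ℝ} (hr : r = -((q : ℝ) + 1))
    {f : SmoothPunctured m} (hf : f ∈ evenHomogeneous m r) :
    kernelOp m q (kernelOp m p f) = (bumpConstant ^ 2) • f := by
  have hdim : q + p + 2 = Module.finrank ℝ (Space m) := by
    rw [finrank_euclideanSpace, Fintype.card_fin]; omega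
  set h := cosTransform (Space m) (cutoffCLM m f) with hh
  set k := cutoffCLM m (kernelOp m p f) with hk
  -- Both terms have `p`-ray integral `bumpConstant * kernelOp m p f`: the first by homogeneity, the
  -- second by definition.
  have hray : ∀ x ≠ 0, rayIntegral p (k - bumpConstant • h : 𝓢(Space m, ℝ)) x = 0 := by
    intro x hx
    have h1 := rayIntegral_cutoff rfl (kernelOp_mem (p := p) rfl hf) hx
    have h2 : rayCLM m p (k - bumpConstant • h) = rayCLM m p k - bumpConstant • rayCLM m p h := by
      rw [map_sub, map_smul]
    have h3 : rayIntegral p (k - bumpConstant • h : 𝓢(Space m, ℝ)) x =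
        rayIntegral p k x - bumpConstant * rayIntegral p h x :=
      congrArg (fun g : SmoothPunctured m => g x) h2
    rw [h3, h1, kernelOp_apply, sub_self]
  refine SmoothPunctured.ext fun x => ?_
  by_cases hx : x = 0
  · rw [hx, SmoothPunctured.map_zero, SmoothPunctured.map_zero]
  have h1 := rayIntegral_cosTransform_eq_zero hdim _ hray hx
  have h2 : rayCLM m q (cosTransform (Space m) (k - bumpConstant • h)) =
      rayCLM m q (cosTransform (Space m) k) -
        bumpConstant • rayCLM m q (cosTransform (Space m) h) := by
    rw [map_sub, map_smul, map_sub, map_smul]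
  have h3 : rayIntegral q (cosTransform (Space m) (k - bumpConstant • h)) x =
      rayIntegral q (cosTransform (Space m) k) x -
        bumpConstant * rayIntegral q (cosTransform (Space m) h) x :=
    congrArg (fun g : SmoothPunctured m => g x) h2
  have h4 : cosTransform (Space m) h = cutoffCLM m f :=
    cosTransform_cosTransform (cutoffCLM_even hf.1)
  rw [h3, h4, rayIntegral_cutoff hr hf hx] at h1
  change rayIntegral q (cosTransform (Space m) k) x = bumpConstant ^ 2 * f x
  linarith

/-- The operator `kernelOp` restricted to even homogeneous functions. -/
def kernelCLM (m p : ℕ) (q : ℝ) {r : ℝ} (hr : r = -((p : ℝ) + 1)) :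
    evenHomogeneous m q →L[ℝ] evenHomogeneous m r :=
  ((kernelOp m p).comp (evenHomogeneous m q).subtypeL).codRestrict _ fun f => kernelOp_mem hr f.2

/-- Multiples of `kernelOp` are isomorphisms between spaces of even homogeneous functions. -/
def kernelEquiv {m p q : ℕ} (hpq : p + q + 1 = m) {r s : ℝ} (hr : r = -((q : ℝ) + 1))
    (hs : s = -((p : ℝ) + 1)) {a : ℝ} (ha : a ≠ 0) :
    evenHomogeneous m r ≃L[ℝ] evenHomogeneous m s :=
  ContinuousLinearEquiv.equivOfInverse (a • kernelCLM m p r hs)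
    ((a * bumpConstant ^ 2)⁻¹ • kernelCLM m q s hr)
    (fun f => Subtype.ext (by
      change (a * bumpConstant ^ 2)⁻¹ • kernelOp m q (a • kernelOp m p f) = f
      have hc := bumpConstant_pos.ne'
      rw [map_smul, kernelOp_kernelOp hpq hr f.2, smul_smul, smul_smul,
        show (a * bumpConstant ^ 2)⁻¹ * a * bumpConstant ^ 2 = 1 by field_simp, one_smul]))
    (fun f => Subtype.ext (by
      change a • kernelOp m p ((a * bumpConstant ^ 2)⁻¹ • kernelOp m q f) = f
      have hc := bumpConstant_pos.ne'
      rw [map_smul, kernelOp_kernelOp (by omega) hs f.2, smul_smul, smul_smul,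
        show a * (a * bumpConstant ^ 2)⁻¹ * bumpConstant ^ 2 = 1 by field_simp, one_smul]))

theorem kernelEquiv_apply {m p q : ℕ} (hpq : p + q + 1 = m) {r s : ℝ} (hr : r = -((q : ℝ) + 1))
    (hs : s = -((p : ℝ) + 1)) {a : ℝ} (ha : a ≠ 0) (f : evenHomogeneous m r) (x : Space m) :
    (kernelEquiv hpq hr hs ha f : SmoothPunctured m) x =
      a * kernelOp m p (f : SmoothPunctured m) x := rfl

/-! ### The Radon transform in terms of the cosine transform -/

section Radon

variable {d : ℕ}

theorem range_sphere_eq {ζ : Space (d + 1)}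
    (L : EuclideanSpace ℝ (Fin (d + 1)) ≃ₗᵢ[ℝ] (ℝ ∙ ζ)ᗮ) :
    range (fun x : Metric.sphere (0 : EuclideanSpace ℝ (Fin (d + 1))) 1 => (L x : Space (d + 1))) =
      Metric.sphere 0 1 ∩ {x | inner ℝ ζ x = 0} := by
  ext y
  constructor
  · rintro ⟨x, rfl⟩
    refine ⟨?_, Submodule.mem_orthogonal_singleton_iff_inner_right.mp (L x).2⟩
    rw [mem_sphere_zero_iff_norm, ← Submodule.coe_norm, L.norm_map]
    exact mem_sphere_zero_iff_norm.mp x.2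
  · rintro ⟨hy1, hy2⟩
    have hy : y ∈ (ℝ ∙ ζ)ᗮ := Submodule.mem_orthogonal_singleton_iff_inner_right.mpr hy2
    refine ⟨⟨L.symm ⟨y, hy⟩, ?_⟩, ?_⟩
    · rw [mem_sphere_zero_iff_norm, L.symm.norm_map]
      exact mem_sphere_zero_iff_norm.mp hy1
    · simp

/-- Hausdorff measure is transported by the isometry `L`, and the averages for Hausdorff and
polar-coordinate measure agree. -/
theorem radonHat_eq {ζ : Space (d + 1)} (L : EuclideanSpace ℝ (Fin (d + 1)) ≃ₗᵢ[ℝ] (ℝ ∙ ζ)ᗮ)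
    {g : Space (d + 1) → ℝ} (hg : ContinuousOn g {0}ᶜ) :
    radonHat (d + 1) g ζ =
      ((volume : Measure (EuclideanSpace ℝ (Fin (d + 1)))).toSphere.real univ)⁻¹ *
        ∫ x : Metric.sphere (0 : EuclideanSpace ℝ (Fin (d + 1))) 1, g (L x)
          ∂(volume : Measure (EuclideanSpace ℝ (Fin (d + 1)))).toSphere := by
  have : Fact (Module.finrank ℝ (EuclideanSpace ℝ (Fin (d + 1))) = d + 1) := ⟨by simp⟩
  have hiso : Isometry (fun x : Metric.sphere (0 : EuclideanSpace ℝ (Fin (d + 1))) 1 =>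
      (L x : Space (d + 1))) :=
    (isometry_subtype_coe.comp L.isometry).comp isometry_subtype_coe
  have hval : Isometry (Subtype.val : Metric.sphere (0 : EuclideanSpace ℝ (Fin (d + 1))) 1 →
      EuclideanSpace ℝ (Fin (d + 1))) := isometry_subtype_coe
  have hcont : Continuous (fun x : Metric.sphere (0 : EuclideanSpace ℝ (Fin (d + 1))) 1 =>
      g (L x)) := by
    refine hg.comp_continuous hiso.continuous fun x h => ?_
    have h1 : ‖(L x : Space (d + 1))‖ = 1 := by
      rw [← Submodule.coe_norm, L.norm_map]
      exact mem_sphere_zero_iff_norm.mp x.2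
    rw [mem_singleton_iff.mp h, norm_zero] at h1
    exact zero_ne_one h1
  rw [← average_hausdorff_eq_average_toSphere (d := d) hcont, radonHat, Nat.add_sub_cancel,
    ← range_sphere_eq L, ← hiso.map_euclideanHausdorffMeasure,
    hiso.isClosedEmbedding.measurableEmbedding.integral_map]
  congr 2
  rw [Measure.real, Measure.real, ← hval.euclideanHausdorffMeasure_image, image_univ,
    Subtype.range_coe]

theorem integral_cutoff_orthogonal {ζ : Space (d + 1)}
    (L : EuclideanSpace ℝ (Fin (d + 1)) ≃ₗᵢ[ℝ] (ℝ ∙ ζ)ᗮ) {g : SmoothPunctured (d + 1)}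
    (hg : g ∈ evenHomogeneous (d + 1) (-((d + 1 : ℕ) : ℝ))) :
    ∫ y : (ℝ ∙ ζ)ᗮ, cutoffCLM (d + 1) g y =
      (∫ y : EuclideanSpace ℝ (Fin (d + 1)), radialWeight (d + 1) ‖y‖) *
        radonHat (d + 1) g ζ := by
  have hT : (volume : Measure (EuclideanSpace ℝ (Fin (d + 1)))).toSphere.real univ ≠ 0 := by
    rw [Ne, measureReal_eq_zero_iff, Measure.measure_univ_eq_zero]
    exact Measure.toSphere_ne_zero _
  rw [radonHat_eq L g.2.1.continuousOn,
    ← L.measurePreserving.integral_comp L.toHomeomorph.measurableEmbedding]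
  -- Polar coordinates for the constant function `1` express the radial integral through the total
  -- mass of the sphere and the integral of the weight.
  have h1 := integral_radial_mul (F := EuclideanSpace ℝ (Fin (d + 1))) (radialWeight (d + 1))
    (fun _ => 1)
  simp only [mul_one, integral_const, smul_eq_mul] at h1
  have h2 := integral_radial_mul (F := EuclideanSpace ℝ (Fin (d + 1))) (radialWeight (d + 1))
    (fun y => g (L y))
  have h3 : ∀ y : EuclideanSpace ℝ (Fin (d + 1)), cutoffCLM (d + 1) g (L y) =
      radialWeight (d + 1) ‖y‖ * g (L (‖y‖⁻¹ • y)) := by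
    intro y
    by_cases hy : y = 0
    · simp [hy, cutoffCLM_apply, g.map_zero]
    have hy' : 0 < ‖y‖ := norm_pos_iff.mpr hy
    have hz : (L (‖y‖⁻¹ • y) : Space (d + 1)) ≠ 0 := by
      simp [hy]
    have h4 := hg.2 ‖y‖ hy' _ hz
    rw [map_smul, Submodule.coe_smul, smul_smul, mul_inv_cancel₀ hy'.ne', one_smul,
      Real.rpow_neg hy'.le, Real.rpow_natCast] at h4
    rw [cutoffCLM_apply, cutoff, h4, radialWeight_eq _ hy', ← Submodule.coe_norm, L.norm_map,
      map_smul, Submodule.coe_smul, mul_assoc]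
  simp only [h3]
  rw [h2, h1]
  field_simp

/-- The Radon transform of an even homogeneous function of degree `-m` is a multiple of
`kernelOp m 0`. -/
theorem kernelOp_zero_eq_radon {g : SmoothPunctured (d + 1)}
    (hg : g ∈ evenHomogeneous (d + 1) (-((d + 1 : ℕ) : ℝ))) (Z : Space (d + 1)) :
    kernelOp (d + 1) 0 g Z =
      (2⁻¹ * ∫ y : EuclideanSpace ℝ (Fin (d + 1)), radialWeight (d + 1) ‖y‖) *
        radon (d + 1) g Z := by
  by_cases hZ : Z = 0
  · rw [hZ, SmoothPunctured.map_zero, radon, norm_zero, inv_zero, zero_mul, mul_zero]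
  have hZ' : 0 < ‖Z‖ := norm_pos_iff.mpr hZ
  set ζ : Space (d + 1) := ‖Z‖⁻¹ • Z with hζdef
  have hζ : ‖ζ‖ = 1 := norm_smul_inv_norm hZ
  have hζ0 : ζ ≠ 0 := by rw [← norm_ne_zero_iff, hζ]; exact one_ne_zero
  have : Fact (Module.finrank ℝ (Space (d + 1)) = d + 1 + 1) := ⟨by simp⟩
  set L : EuclideanSpace ℝ (Fin (d + 1)) ≃ₗᵢ[ℝ] (ℝ ∙ ζ)ᗮ :=
    (OrthonormalBasis.fromOrthogonalSpanSingleton (d + 1) hζ0).repr.symm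
  have h1 : Z = ‖Z‖ • ζ := by rw [hζdef, smul_smul, mul_inv_cancel₀ hZ'.ne', one_smul]
  have h2 : kernelOp (d + 1) 0 g Z = ‖Z‖⁻¹ * rayIntegral 0
      (cosTransform (Space (d + 1)) (cutoffCLM (d + 1) g)) ζ := by
    rw [kernelOp_apply]
    conv_lhs => rw [h1]
    rw [rayIntegral_smul 0 _ hZ', smul_eq_mul, Nat.cast_zero, zero_add, Real.rpow_neg_one]
  rw [h2, rayIntegral_cosTransform_zero hζ (cutoffCLM_even hg.1), integral_cutoff_orthogonal L hg,
    radon]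
  ring

end Radon

end SphericalRadon

end

/-! ### The main theorem -/

theorem mainTheorem9 (m : ℕ) (hm : 1 ≤ m) :
    SphericalRadon.IsFrechetSpace (SphericalRadon.evenHomogeneous m (-(m : ℝ))) ∧
    SphericalRadon.IsFrechetSpace (SphericalRadon.evenHomogeneous m (-1)) ∧
    ∃ R : SphericalRadon.evenHomogeneous m (-(m : ℝ)) ≃L[ℝ]
        SphericalRadon.evenHomogeneous m (-1),
      ∀ (g : SphericalRadon.evenHomogeneous m (-(m : ℝ))) (Z : SphericalRadon.Space m),
        (R g : SphericalRadon.SmoothPunctured m) Z =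
          SphericalRadon.radon m (g : SphericalRadon.SmoothPunctured m) Z := by
  refine ⟨SphericalRadon.isFrechetSpace_evenHomogeneous m _,
    SphericalRadon.isFrechetSpace_evenHomogeneous m _, ?_⟩
  obtain ⟨d, rfl⟩ : ∃ d, m = d + 1 := ⟨m - 1, by omega⟩
  have hκ := SphericalRadon.integral_radialWeight_norm_pos (d + 1)
    (F := EuclideanSpace ℝ (Fin (d + 1)))
  -- Here `q = d = m - 1` gives the source degree `-m` and `p = 0` the target degree `-1`; the
  -- scalar is the reciprocal of the constant in `kernelOp_zero_eq_radon`.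
  refine ⟨SphericalRadon.kernelEquiv (p := 0) (q := d) (by omega) (by push_cast; rfl)
    (by norm_num) (inv_ne_zero (mul_pos (inv_pos.mpr two_pos) hκ).ne'), fun g Z => ?_⟩
  rw [SphericalRadon.kernelEquiv_apply, SphericalRadon.kernelOp_zero_eq_radon g.2, ← mul_assoc,
    inv_mul_cancel₀ (mul_pos (inv_pos.mpr two_pos) hκ).ne', one_mul]
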